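/- **Lemma (Trace Variance Estimation).** Let $\mathcal M$ be a (time-homogeneous) Markov chain on a finite state space $\Omega$ with transition matrix $\mathcal M(x,y)$ and stationary distribution $\pi$. Let $f:\Omega\to[a,b]$ with $a<b$, $R=b-a$, $\mu=\mathbb E_\pi[f]$, and let $v_\pi=\mathbb E_\pi[(f-\mu)^2]$ be the stationary variance. Let $m\ge 1$ and let $\vec X_1=(X_{1,1},\dots,X_{1,m})$ and $\vec X_2=(X_{2,1},\dots,X_{2,m})$ be two independent stationary length-$m$ traces of $\mathcal M$, i.e. each takes the value $(w_1,\dots,w_m)$ with probability $\pi(w_1)\prod_{i=1}^{m-1}\mathcal M(w_i,w_{i+1})$. Put $$\hat v=\frac1{2m}\sum_{i=1}^m\bigl(f(X_{1,i})-f(X_{2,i})\bigr)^2 .$$ For $\ell\in[0,1)$ and $\delta\in(0,1)$ let $B(\ell,\delta)$ denote the assertion $$\mathbb P\left(v_\pi\ \ge\ \hat v+\frac{(11+\sqrt{21})\bigl(1+\frac{\ell}{\sqrt{21}}\bigr)R^2\ln\frac1\delta}{(1-\ell)m}+\sqrt{\frac{(1+\ell)R^2\,\hat v\,\ln\frac1\delta}{(1-\ell)m}}\right)\le\delta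 .$$ 1. $\hat v$ is integrable and $\mathbb E[\hat v]=v_\pi$, so $\hat v$ is an unbiased estimator of $v_\pi$. 2. If $\mathcal M$ is ergodic (irreducible and aperiodic) and reversible, let $\lambda=\max\{|\gamma| : \gamma\ne1 \text{ an eigenvalue of } \mathcal M\}$ be its second largest absolute eigenvalue ($\lambda=0$ if $|\Omega|=1$); if $\mathcal M$ is also lazy, this is its second largest eigenvalue. Then $\lambda<1$ and $B(\lambda,\delta)$ holds for every $\delta\in(0,1)$. 3. Without reversibility, let $\lambda_*=\sup\{\lVert \mathcal M h\rVert_{L^2(\pi)} : \mathbb E_\pi[h]=0,\ \lVert h\rVert_{L^2(\pi)}\le1\}$, so that $1-\lambda_*$ is the absolute $L^2$ spectral gap. If $\mathcal M$ is ergodic and lazy, that is $\mathcal M(x,x)\ge\frac12$ for all $x$, then $\lambda_*<1$. Whenever $\lambda_*<1$, $B(\lambda_*,\delta)$ holds for every $\delta\in(0,1)$. -/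

import Mathlib

open MeasureTheory ProbabilityTheory

namespace TraceVariance

noncomputable section

variable {Ω : Type*} [Fintype Ω] [DecidableEq Ω]

/-- `π` is a probability distribution on `Ω` that is stationary for the transition matrix `M`. -/
def IsStationaryDist (M : Matrix Ω Ω ℝ) (π : Ω → ℝ) : Prop :=
  π ∈ stdSimplex ℝ Ω ∧ Matrix.vecMul π M = π

/-- Every state `x` has period one: the only common divisor of the lengths `k ≥ 1` of possible
returns to `x` is `1`. -/
def IsAperiodic (M : Matrix Ω Ω ℝ) : Prop :=
  ∀ (x : Ω) (d : ℕ), (∀ k : ℕ, 1 ≤ k → 0 < (M ^ k) x x → d ∣ k) → d = 1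

/-- An ergodic chain on a finite state space: irreducible and aperiodic. -/
def IsErgodicChain (M : Matrix Ω Ω ℝ) : Prop :=
  M.IsIrreducible ∧ IsAperiodic M

/-- A lazy chain stays where it is with probability at least `1/2`. -/
def IsLazy (M : Matrix Ω Ω ℝ) : Prop :=
  ∀ x, 1 / 2 ≤ M x x

/-- Detailed balance. -/
def IsReversibleChain (M : Matrix Ω Ω ℝ) (π : Ω → ℝ) : Prop :=
  ∀ x y, π x * M x y = π y * M y x

/-- The second largest absolute eigenvalue: the largest `|γ|` over the complex eigenvalues `γ ≠ 1`
of `M`. It is `0` for a one-state chain, which has no such eigenvalue. -/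
def secondEigenvalue (M : Matrix Ω Ω ℝ) : ℝ :=
  sSup {r : ℝ | ∃ γ : ℂ,
    Module.End.HasEigenvalue (Matrix.toLin' (M.map Complex.ofReal)) γ ∧ γ ≠ 1 ∧ r = ‖γ‖}

/-- Expectation of a function under `π`. -/
def expect (π : Ω → ℝ) (h : Ω → ℝ) : ℝ :=
  ∑ x, π x * h x

/-- The norm of `L²(π)`. -/
def l2Norm (π : Ω → ℝ) (h : Ω → ℝ) : ℝ :=
  Real.sqrt (∑ x, π x * h x ^ 2)

/-- The operator norm of `M` on the functions of mean zero in `L²(π)`. -/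
def l2Contraction (M : Matrix Ω Ω ℝ) (π : Ω → ℝ) : ℝ :=
  sSup {r : ℝ | ∃ h : Ω → ℝ, expect π h = 0 ∧ l2Norm π h ≤ 1 ∧ r = l2Norm π (M.mulVec h)}

/-- The stationary variance of `f`. -/
def stationaryVariance (π : Ω → ℝ) (f : Ω → ℝ) : ℝ :=
  expect π (fun x => (f x - expect π f) ^ 2)

/-- The probability `π(w₁) M(w₁, w₂) ⋯ M(wₘ₋₁, wₘ)` that a stationary trace of length `m` equals
the word `w`, whose letters are numbered from `0` here. -/
def traceProb (M : Matrix Ω Ω ℝ) (π : Ω → ℝ) {m : ℕ} (w : Fin m → Ω) : ℝ :=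
  ∏ i : Fin m, if (i : ℕ) = 0 then π (w i)
    else M (w ⟨(i : ℕ) - 1, lt_of_le_of_lt (Nat.sub_le _ _) i.isLt⟩) (w i)

/-- `X` is a length-`m` trace of the chain `M`, started from its stationary distribution `π`. -/
def IsStationaryTrace {S : Type*} [MeasurableSpace S] [MeasurableSpace Ω] (P : Measure S)
    (M : Matrix Ω Ω ℝ) (π : Ω → ℝ) {m : ℕ} (X : Fin m → S → Ω) : Prop :=
  (∀ i, Measurable (X i)) ∧ ∀ w : Fin m → Ω, P.real {s | ∀ i, X i s = w i} = traceProb M π w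

end

/-- The two-chain variance estimator. -/
noncomputable def twoChainEstimator {Ω S : Type*} {m : ℕ} (f : Ω → ℝ) (X₁ X₂ : Fin m → S → Ω)
    (s : S) : ℝ :=
  1 / (2 * (m : ℝ)) * ∑ i, (f (X₁ i s) - f (X₂ i s)) ^ 2

/-- The upper confidence bound for the variance, computed from the value `v` of the estimator. -/
noncomputable def upperBound (l R δ : ℝ) (m : ℕ) (v : ℝ) : ℝ :=
  v + (11 + Real.sqrt 21) * (1 + l / Real.sqrt 21) * R ^ 2 * Real.log (1 / δ) / ((1 - l) * m)
    + Real.sqrt ((1 + l) * R ^ 2 * v * Real.log (1 / δ) / ((1 - l) * m))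

end TraceVariance

namespace TraceVariance

/-! ### Mean-zero contraction and the comparison kernel -/

section Contraction

variable {Ω : Type*} [Fintype Ω]

/-! Two independent traces form one stationary trace of the product chain, along which g(x, y) = (f
x - f y)² / R² takes values in [0, 1] and has mean p = 2v/R². Stationarity and linearity give
unbiasedness. The confidence bound is a multiplicative Chernoff bound for the lower tail of ∑ g,
solved for v.

By convexity exp(-t g) ≤ d := 1 - θ g with θ = 1 - exp(-t), and the expected product of d along a
trace is a matrix element of powers of h ↦ M (d h). If M contracts mean-zero functions by l, its
bilinear form is dominated by that of (1 - l) π + l I (`sq_expect_mul_mulVec_le`). Tilted by d, this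
kernel is a rank-one perturbation of a diagonal operator, so its top eigenvalue is controlled by a
scalar secular inequality (`mixForm_mul_le`). The value ρ = 1 - p F satisfies it, and with β = (1 +
l)/(1 - l) this yields E exp(-t ∑ g) ≤ exp(-m p (t - β t²/2)). Optimising t bounds the probability
of v̂ ≤ v - √(B v) by δ, where B = β R² ln(1/δ) / m. Inverting this needs only an additive term of
at least B, so the stated constant leaves ample room.

It remains to supply l. Contraction passes to the product chain with the same l
(`ContractsMeanZero.pair`), and λ_* contracts by definition. For a reversible chain a maximiser of
‖M h‖ produces an eigenvector, whence λ_* ≤ λ, while a Doeblin minorisation gives λ < 1. For a lazy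
chain 2M - I is again stochastic, which forces λ_* < 1. -/

lemma expect_add (π g h : Ω → ℝ) :
    expect π (fun x => g x + h x) = expect π g + expect π h := by
  simp only [expect, mul_add, Finset.sum_add_distrib]

lemma expect_sub (π g h : Ω → ℝ) :
    expect π (fun x => g x - h x) = expect π g - expect π h := by
  simp only [expect, mul_sub, Finset.sum_sub_distrib]

lemma expect_const_mul (π : Ω → ℝ) (c : ℝ) (h : Ω → ℝ) :
    expect π (fun x => c * h x) = c * expect π h := by
  simp only [expect, Finset.mul_sum]
  exact Finset.sum_congr rfl fun x _ => by ring

lemma expect_const {π : Ω → ℝ} (hπ : π ∈ stdSimplex ℝ Ω) (c : ℝ) :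
    expect π (fun _ => c) = c := by
  simp only [expect, ← Finset.sum_mul, hπ.2, one_mul]

lemma expect_mono {π : Ω → ℝ} (hπ : π ∈ stdSimplex ℝ Ω) {g h : Ω → ℝ} (hgh : ∀ x, g x ≤ h x) :
    expect π g ≤ expect π h :=
  Finset.sum_le_sum fun x _ => mul_le_mul_of_nonneg_left (hgh x) (hπ.1 x)

lemma expect_nonneg {π : Ω → ℝ} (hπ : π ∈ stdSimplex ℝ Ω) {h : Ω → ℝ} (hh : ∀ x, 0 ≤ h x) :
    0 ≤ expect π h :=
  Finset.sum_nonneg fun x _ => mul_nonneg (hπ.1 x) (hh x)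

/-- Cauchy–Schwarz, for `r ^ 2 = g * h` with `g`, `h` nonnegative. -/
lemma sq_expect_le {π : Ω → ℝ} (hπ : π ∈ stdSimplex ℝ Ω) {r g h : Ω → ℝ} (hg : ∀ x, 0 ≤ g x)
    (hh : ∀ x, 0 ≤ h x) (hr : ∀ x, r x ^ 2 = g x * h x) :
    expect π r ^ 2 ≤ expect π g * expect π h := by
  refine Finset.sum_sq_le_sum_mul_sum_of_sq_le_mul _ (fun x _ => mul_nonneg (hπ.1 x) (hg x))
    (fun x _ => mul_nonneg (hπ.1 x) (hh x)) fun x _ => ?_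
  rw [mul_pow, hr]
  exact (by ring : _ = _).le

lemma sq_expect_le_expect_sq {π : Ω → ℝ} (hπ : π ∈ stdSimplex ℝ Ω) (h : Ω → ℝ) :
    expect π h ^ 2 ≤ expect π (fun x => h x ^ 2) := by
  have := sq_expect_le hπ (r := h) (g := fun _ => 1) (h := fun x => h x ^ 2)
    (fun _ => zero_le_one) (fun x => sq_nonneg _) (fun x => (one_mul _).symm)
  rwa [expect_const hπ, one_mul] at this

lemma expect_mulVec {M : Matrix Ω Ω ℝ} {π : Ω → ℝ} (hπ : IsStationaryDist M π) (h : Ω → ℝ) :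
    expect π (M.mulVec h) = expect π h := by
  change π ⬝ᵥ M.mulVec h = π ⬝ᵥ h
  rw [Matrix.dotProduct_mulVec, hπ.2]

lemma sq_mulVec_le [DecidableEq Ω]
    {M : Matrix Ω Ω ℝ} (hM : M ∈ Matrix.rowStochastic ℝ Ω) (h : Ω → ℝ) (x : Ω) :
    M.mulVec h x ^ 2 ≤ M.mulVec (fun y => h y ^ 2) x := by
  have := sq_expect_le_expect_sq (π := M x) ⟨fun y => hM.1 x y,
    Matrix.sum_row_of_mem_rowStochastic hM x⟩ h
  exact this

lemma expect_sq_mulVec_le [DecidableEq Ω]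
    {M : Matrix Ω Ω ℝ} (hM : M ∈ Matrix.rowStochastic ℝ Ω) {π : Ω → ℝ}
    (hπ : IsStationaryDist M π) (h : Ω → ℝ) :
    expect π (fun x => M.mulVec h x ^ 2) ≤ expect π (fun x => h x ^ 2) := by
  rw [← expect_mulVec hπ (fun x => h x ^ 2)]
  exact expect_mono hπ.1 fun x => sq_mulVec_le hM h x

lemma mulVec_const [DecidableEq Ω]
    {M : Matrix Ω Ω ℝ} (hM : M ∈ Matrix.rowStochastic ℝ Ω) (c : ℝ) :
    M.mulVec (fun _ => c) = fun _ => c := by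
  ext x
  simp only [Matrix.mulVec, dotProduct, ← Finset.sum_mul,
    Matrix.sum_row_of_mem_rowStochastic hM x, one_mul]

/-- `M` shrinks the functions of mean zero in `L²(π)` by the factor `l`. -/
def ContractsMeanZero (M : Matrix Ω Ω ℝ) (π : Ω → ℝ) (l : ℝ) : Prop :=
  ∀ h : Ω → ℝ, expect π h = 0 →
    expect π (fun x => M.mulVec h x ^ 2) ≤ l ^ 2 * expect π (fun x => h x ^ 2)

/-- The quadratic form of the kernel `(1 - l) π + l I`. -/
noncomputable def mixForm (π : Ω → ℝ) (l : ℝ) (u : Ω → ℝ) : ℝ :=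
  (1 - l) * expect π u ^ 2 + l * expect π (fun x => u x ^ 2)

/-- Cauchy–Schwarz for the form a² + l U: the cross term 2abz is absorbed by AM-GM. -/
lemma sq_add_le_of_sq_le {a b z l U W : ℝ} (hl : 0 ≤ l) (hU : 0 ≤ U) (hW : 0 ≤ W)
    (hz : z ^ 2 ≤ l ^ 2 * (U * W)) :
    (a * b + z) ^ 2 ≤ (a ^ 2 + l * U) * (b ^ 2 + l * W) := by
  have key : 2 * (a * b) * z ≤ l * (a ^ 2 * W + b ^ 2 * U) := by
    refine abs_le_of_sq_le_sq' ?_ (by positivity) |>.2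
    calc (2 * (a * b) * z) ^ 2 = 4 * (a * b) ^ 2 * z ^ 2 := by ring
      _ ≤ 4 * (a * b) ^ 2 * (l ^ 2 * (U * W)) := by gcongr
      _ ≤ (l * (a ^ 2 * W + b ^ 2 * U)) ^ 2 := by
        nlinarith [mul_nonneg (sq_nonneg l) (sq_nonneg (a ^ 2 * W - b ^ 2 * U))]
  nlinarith

/-- Splitting off means, ⟨u, M w⟩ is the product of the means plus a centred part of size at most l
times the standard deviations, while `mixForm` is mean² + l · variance. No symmetry of M is needed.
-/
lemma sq_expect_mul_mulVec_le [DecidableEq Ω]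
    {M : Matrix Ω Ω ℝ} (hM : M ∈ Matrix.rowStochastic ℝ Ω) {π : Ω → ℝ}
    (hπ : IsStationaryDist M π) {l : ℝ} (hl : 0 ≤ l) (hc : ContractsMeanZero M π l)
    (u w : Ω → ℝ) :
    expect π (fun x => u x * M.mulVec w x) ^ 2 ≤ mixForm π l u * mixForm π l w := by
  have centre : ∀ h : Ω → ℝ, expect π (fun x => h x - expect π h) = 0 := fun h => by
    rw [expect_sub, expect_const hπ.1, sub_self]
  have var : ∀ h : Ω → ℝ, expect π (fun x => (h x - expect π h) ^ 2) =
      expect π (fun x => h x ^ 2) - expect π h ^ 2 := fun h => by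
    have : (fun x => (h x - expect π h) ^ 2) =
        fun x => (h x ^ 2 - 2 * expect π h * h x) + expect π h ^ 2 := by
      ext x; ring
    rw [this, expect_add, expect_sub, expect_const_mul, expect_const hπ.1]
    ring
  set a := expect π u with ha
  set b := expect π w with hb
  set z := expect π (fun x => (u x - a) * M.mulVec (fun y => w y - b) x) with hz
  have hMw : M.mulVec w = fun x => M.mulVec (fun y => w y - b) x + b := by
    have : (fun y => w y - b) = w - fun _ => b := rfl
    rw [this, Matrix.mulVec_sub, mulVec_const hM]
    ext x; simp
  have hsplit : expect π (fun x => u x * M.mulVec w x) = a * b + z := by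
    have h0 : expect π (M.mulVec fun y => w y - b) = 0 := by
      rw [expect_mulVec hπ, centre]
    have : (fun x => u x * M.mulVec w x) = fun x =>
        ((u x - a) * M.mulVec (fun y => w y - b) x + a * M.mulVec (fun y => w y - b) x)
          + b * u x := by
      ext x; rw [hMw]; ring
    rw [this, expect_add, expect_add, expect_const_mul, expect_const_mul, ← hz, h0, ← ha]
    ring
  have hU := expect_nonneg hπ.1 (fun x => sq_nonneg (u x - a))
  have hW := expect_nonneg hπ.1 (fun x => sq_nonneg (w x - b))
  have hz2 : z ^ 2 ≤ l ^ 2 * (expect π (fun x => (u x - a) ^ 2) *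
      expect π (fun x => (w x - b) ^ 2)) := by
    calc z ^ 2 ≤ expect π (fun x => (u x - a) ^ 2) *
          expect π (fun x => M.mulVec (fun y => w y - b) x ^ 2) :=
        sq_expect_le hπ.1 (fun _ => sq_nonneg _) (fun _ => sq_nonneg _) fun x => mul_pow _ _ _
      _ ≤ expect π (fun x => (u x - a) ^ 2) * (l ^ 2 * expect π (fun x => (w x - b) ^ 2)) := by
        gcongr
        exact hc _ (centre w)
      _ = _ := by ring
  rw [hsplit]
  refine (sq_add_le_of_sq_le hl hU hW hz2).trans_eq ?_
  rw [var u, var w, mixForm, mixForm]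
  ring

end Contraction

/-! ### Tilted operators and the secular inequality -/

section Tilting

variable {Ω : Type*} [Fintype Ω]

/-- The one-step bound behind the estimate of `E[∏ d(Xᵢ)]`. -/
lemma mixForm_mul_le {π : Ω → ℝ} (hπ : π ∈ stdSimplex ℝ Ω) {l ρ : ℝ} (hl1 : l ≤ 1)
    {d : Ω → ℝ} (hd : ∀ x, 0 ≤ d x) (hρ : ∀ x, l * d x < ρ)
    (hE : expect π (fun x => (1 - l) * d x / (ρ - l * d x)) ≤ 1) (w : Ω → ℝ) :
    mixForm π l (fun x => d x * w x) ≤ ρ * expect π (fun x => d x * w x ^ 2) := by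
  have hpos : ∀ x, 0 < ρ - l * d x := fun x => sub_pos.2 (hρ x)
  have hB : 0 ≤ expect π (fun x => (ρ - l * d x) * d x * w x ^ 2) :=
    expect_nonneg hπ fun x => mul_nonneg (mul_nonneg (hpos x).le (hd x)) (sq_nonneg _)
  -- Cauchy–Schwarz with the weight ρ - l d, the diagonal left after the rank-one part is removed;
  -- `hE` says the rank-one part does not exceed it.
  have hcs : (1 - l) * expect π (fun x => d x * w x) ^ 2 ≤
      expect π (fun x => (ρ - l * d x) * d x * w x ^ 2) := by
    have h1 : expect π (fun x => d x * w x) ^ 2 ≤ expect π (fun x => d x / (ρ - l * d x)) *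
        expect π (fun x => (ρ - l * d x) * d x * w x ^ 2) := by
      refine sq_expect_le hπ (fun x => div_nonneg (hd x) (hpos x).le)
        (fun x => mul_nonneg (mul_nonneg (hpos x).le (hd x)) (sq_nonneg _)) fun x => ?_
      rw [div_mul_eq_mul_div, eq_div_iff (hpos x).ne']
      ring
    calc (1 - l) * expect π (fun x => d x * w x) ^ 2
        ≤ (1 - l) * (expect π (fun x => d x / (ρ - l * d x)) *
          expect π (fun x => (ρ - l * d x) * d x * w x ^ 2)) :=
        mul_le_mul_of_nonneg_left h1 (sub_nonneg.2 hl1)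
      _ = expect π (fun x => (1 - l) * d x / (ρ - l * d x)) *
          expect π (fun x => (ρ - l * d x) * d x * w x ^ 2) := by
        rw [← mul_assoc, ← expect_const_mul π (1 - l) (fun x => d x / (ρ - l * d x))]
        simp only [mul_div_assoc]
      _ ≤ 1 * expect π (fun x => (ρ - l * d x) * d x * w x ^ 2) :=
        mul_le_mul_of_nonneg_right hE hB
      _ = _ := one_mul _
  have hsplit : expect π (fun x => (ρ - l * d x) * d x * w x ^ 2) =
      ρ * expect π (fun x => d x * w x ^ 2) - l * expect π (fun x => (d x * w x) ^ 2) := by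
    rw [← expect_const_mul, ← expect_const_mul, ← expect_sub]
    congr 1
    ext x
    ring
  rw [mixForm]
  linarith

lemma expect_le_of_tilt {π : Ω → ℝ} (hπ : π ∈ stdSimplex ℝ Ω) {l ρ : ℝ} (hl : 0 ≤ l)
    (hl1 : l ≤ 1) (hρ0 : 0 ≤ ρ) {d : Ω → ℝ} (hd : ∀ x, 0 ≤ d x) (hρ : ∀ x, l * d x < ρ)
    (hE : expect π (fun x => (1 - l) * d x / (ρ - l * d x)) ≤ 1) : expect π d ≤ ρ := by
  have h := mixForm_mul_le hπ hl1 hd hρ hE (fun _ => 1)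
  simp only [mul_one, one_pow, mixForm] at h
  have h2 := mul_le_mul_of_nonneg_left (sq_expect_le_expect_sq hπ d) hl
  rcases (expect_nonneg hπ hd).eq_or_lt with h0 | h0
  · exact h0 ▸ hρ0
  · nlinarith

/-- The operator `h ↦ M (d h)`. -/
def tilt (M : Matrix Ω Ω ℝ) (d : Ω → ℝ) (h : Ω → ℝ) : Ω → ℝ :=
  M.mulVec fun x => d x * h x

/-- The norm is that of L²(d π). With T the tilt, ‖T w‖² = ⟨d T w, M (d w)⟩, so comparison with
`mixForm` bounds its square by ρ² ‖T w‖² ‖w‖²; one factor ‖T w‖² cancels. -/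
lemma expect_tilt_sq_le [DecidableEq Ω]
    {M : Matrix Ω Ω ℝ} (hM : M ∈ Matrix.rowStochastic ℝ Ω) {π : Ω → ℝ}
    (hπ : IsStationaryDist M π) {l ρ : ℝ} (hl : 0 ≤ l) (hl1 : l ≤ 1) (hρ0 : 0 ≤ ρ)
    (hc : ContractsMeanZero M π l) {d : Ω → ℝ} (hd : ∀ x, 0 ≤ d x) (hρ : ∀ x, l * d x < ρ)
    (hE : expect π (fun x => (1 - l) * d x / (ρ - l * d x)) ≤ 1) (w : Ω → ℝ) :
    expect π (fun x => d x * tilt M d w x ^ 2) ≤ ρ ^ 2 * expect π (fun x => d x * w x ^ 2) := by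
  have hA : 0 ≤ expect π (fun x => d x * tilt M d w x ^ 2) :=
    expect_nonneg hπ.1 fun x => mul_nonneg (hd x) (sq_nonneg _)
  have hB : 0 ≤ expect π (fun x => d x * w x ^ 2) :=
    expect_nonneg hπ.1 fun x => mul_nonneg (hd x) (sq_nonneg _)
  have h1 := sq_expect_mul_mulVec_le hM hπ hl hc (fun x => d x * tilt M d w x)
    (fun x => d x * w x)
  have h2 : (fun x => d x * tilt M d w x * M.mulVec (fun x => d x * w x) x) =
      fun x => d x * tilt M d w x ^ 2 := by
    ext x; simp only [tilt]; ring
  rw [h2] at h1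
  have h3 := mixForm_mul_le hπ.1 hl1 hd hρ hE (tilt M d w)
  have h4 := mixForm_mul_le hπ.1 hl1 hd hρ hE w
  have h5 : 0 ≤ mixForm π l (fun x => d x * w x) :=
    add_nonneg (mul_nonneg (sub_nonneg.2 hl1) (sq_nonneg _))
      (mul_nonneg hl (expect_nonneg hπ.1 fun x => sq_nonneg _))
  have h6 := h1.trans (mul_le_mul h3 h4 h5 (mul_nonneg hρ0 hA))
  rcases hA.eq_or_lt with h0 | h0
  · rw [← h0]; positivity
  · nlinarith

lemma expect_mul_iterate_tilt_le [DecidableEq Ω]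
    {M : Matrix Ω Ω ℝ} (hM : M ∈ Matrix.rowStochastic ℝ Ω)
    {π : Ω → ℝ} (hπ : IsStationaryDist M π) {l ρ : ℝ} (hl : 0 ≤ l) (hl1 : l ≤ 1) (hρ0 : 0 ≤ ρ)
    (hc : ContractsMeanZero M π l) {d : Ω → ℝ} (hd : ∀ x, 0 ≤ d x) (hρ : ∀ x, l * d x < ρ)
    (hE : expect π (fun x => (1 - l) * d x / (ρ - l * d x)) ≤ 1) (k : ℕ) :
    expect π (fun x => d x * (tilt M d)^[k] (fun _ => 1) x) ≤ ρ ^ (k + 1) := by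
  have hdρ := expect_le_of_tilt hπ.1 hl hl1 hρ0 hd hρ hE
  have hd0 := expect_nonneg hπ.1 hd
  have hk : expect π (fun x => d x * (tilt M d)^[k] (fun _ => 1) x ^ 2) ≤
      (ρ ^ k) ^ 2 * expect π d := by
    induction k with
    | zero => simp
    | succ k ih =>
      rw [Function.iterate_succ', Function.comp_apply]
      refine (expect_tilt_sq_le hM hπ hl hl1 hρ0 hc hd hρ hE _).trans ?_
      calc _ ≤ ρ ^ 2 * ((ρ ^ k) ^ 2 * expect π d) := by gcongr
        _ = _ := by ring
  have hcs : expect π (fun x => d x * (tilt M d)^[k] (fun _ => 1) x) ^ 2 ≤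
      expect π d * expect π (fun x => d x * (tilt M d)^[k] (fun _ => 1) x ^ 2) :=
    sq_expect_le hπ.1 hd (fun x => mul_nonneg (hd x) (sq_nonneg _)) fun x => by ring
  -- The k tilts give ρ ^ k; the two factors E[d] ≤ ρ supply the remaining ρ after the square root.
  refine abs_le_of_sq_le_sq' ?_ (by positivity) |>.2
  calc _ ≤ expect π d * ((ρ ^ k) ^ 2 * expect π d) :=
        hcs.trans (mul_le_mul_of_nonneg_left hk hd0)
    _ ≤ ρ * ((ρ ^ k) ^ 2 * ρ) := by gcongr
    _ = _ := by ring

end Tilting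

/-! ### The exponential rate of the lower tail -/

section LowerTail

/-- A nonincreasing nonnegative affine function over a nondecreasing positive one is convex, so it
lies below its chord. -/
lemma chord_le {n₀ n₁ A B g : ℝ} (hA : 0 < A) (hAB : A ≤ B) (hn₁ : 0 ≤ n₁) (hn : n₁ ≤ n₀)
    (hg0 : 0 ≤ g) (hg1 : g ≤ 1) :
    ((1 - g) * n₀ + g * n₁) / ((1 - g) * A + g * B) ≤ (1 - g) * (n₀ / A) + g * (n₁ / B) := by
  have hB : 0 < B := hA.trans_le hAB
  have hD : 0 < (1 - g) * A + g * B := by nlinarith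
  have h1 : (1 - g) * (n₀ / A) + g * (n₁ / B) = ((1 - g) * n₀ * B + g * n₁ * A) / (A * B) := by
    field_simp
  rw [h1, div_le_div_iff₀ hD (mul_pos hA hB)]
  have h2 : 0 ≤ n₀ * B - n₁ * A := sub_nonneg.2 (mul_le_mul hn hAB hA.le (hn₁.trans hn))
  have h3 : 0 ≤ (1 - g) * g * ((B - A) * (n₀ * B - n₁ * A)) :=
    mul_nonneg (mul_nonneg (sub_nonneg.2 hg1) hg0) (mul_nonneg (sub_nonneg.2 hAB) h2)
  linarith

lemma exp_neg_mul_le {t g : ℝ} (hg0 : 0 ≤ g) (hg1 : g ≤ 1) :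
    Real.exp (-t * g) ≤ 1 - (1 - Real.exp (-t)) * g := by
  have := convexOn_exp.2 (Set.mem_univ 0) (Set.mem_univ (-t)) (sub_nonneg.2 hg1) hg0 (by ring)
  simp only [smul_eq_mul, mul_zero, zero_add, Real.exp_zero, mul_one] at this
  rw [mul_comm (-t) g]
  linarith

lemma sub_sq_le_rate {l t : ℝ} (hl : 0 ≤ l) (hl1 : l < 1) (ht : 0 ≤ t) :
    t - (1 + l) / (1 - l) * t ^ 2 / 2 ≤
      (1 - l) * (1 - Real.exp (-t)) / (1 - l + l * (1 - Real.exp (-t))) := by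
  have hq : 0 < 1 - l := sub_pos.2 hl1
  have he := Real.quadratic_le_exp_of_nonneg ht
  have he0 := Real.exp_pos t
  have hF : (1 - l) * (1 - Real.exp (-t)) / (1 - l + l * (1 - Real.exp (-t))) =
      (1 - l) * (Real.exp t - 1) / (Real.exp t - l) := by
    have h1 : 0 < Real.exp t - l := by nlinarith
    have h2 : 1 - l + l * (1 - Real.exp (-t)) = (Real.exp t - l) / Real.exp t := by
      rw [Real.exp_neg]; field_simp; ring
    rw [h2, Real.exp_neg]
    field_simp
  have hX : t - (1 + l) / (1 - l) * t ^ 2 / 2 =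
      (2 * (1 - l) * t - (1 + l) * t ^ 2) / (2 * (1 - l)) := by
    field_simp
  rw [hF, hX, div_le_div_iff₀ (by positivity) (by nlinarith)]
  -- This makes the coefficient of exp t nonnegative, so exp t may be replaced by 1 + t + t²/2; the
  -- t and t² terms then cancel, leaving 2 l t³ + (1 + l) t⁴/2.
  have h3 : 2 * (1 - l) * t - (1 + l) * t ^ 2 ≤ 2 * (1 - l) ^ 2 := by
    nlinarith [sq_nonneg (2 * t - (1 - l)), mul_nonneg hl (sq_nonneg t), mul_nonneg hq.le ht,
      sq_nonneg (t - (1 - l)), mul_nonneg hl (sq_nonneg (1 - l))]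
  have h4 : 0 ≤ (Real.exp t - (1 + t + t ^ 2 / 2)) *
      (2 * (1 - l) ^ 2 - (2 * (1 - l) * t - (1 + l) * t ^ 2)) :=
    mul_nonneg (by linarith) (by linarith)
  have h5 : 0 ≤ l * (1 - l) * t ^ 2 := by positivity
  have h6 : 0 ≤ (1 + l) * t ^ 4 := by positivity
  have h7 : 0 ≤ l * t ^ 3 := by positivity
  nlinarith

variable {Ω : Type*} [Fintype Ω]

lemma expect_mul_iterate_tilt_le_exp [DecidableEq Ω]
    {M : Matrix Ω Ω ℝ} (hM : M ∈ Matrix.rowStochastic ℝ Ω)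
    {π : Ω → ℝ} (hπ : IsStationaryDist M π) {l : ℝ} (hl : 0 ≤ l) (hl1 : l < 1)
    (hc : ContractsMeanZero M π l) {g : Ω → ℝ} (hg0 : ∀ x, 0 ≤ g x) (hg1 : ∀ x, g x ≤ 1)
    {t : ℝ} (ht : 0 ≤ t) (k : ℕ) :
    expect π (fun x => (1 - (1 - Real.exp (-t)) * g x) *
      (tilt M fun x => 1 - (1 - Real.exp (-t)) * g x)^[k] (fun _ => 1) x) ≤
      Real.exp (-((k + 1 : ℕ) * (expect π g * (t - (1 + l) / (1 - l) * t ^ 2 / 2)))) := by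
  have hrate := sub_sq_le_rate hl hl1 ht
  have hq : 0 < 1 - l := sub_pos.2 hl1
  have hθ0 : 0 ≤ 1 - Real.exp (-t) := sub_nonneg.2 (Real.exp_le_one_iff.2 (neg_nonpos.2 ht))
  have hθ1 : 1 - Real.exp (-t) < 1 := sub_lt_self _ (Real.exp_pos _)
  set θ := 1 - Real.exp (-t)
  have hD : 0 < 1 - l + l * θ := by positivity
  -- F is chosen so that the term linear in p vanishes in the secular inequality for ρ = 1 - p F;
  -- only p² F (F - (1 - l) θ) ≥ 0 survives.
  set F := (1 - l) * θ / (1 - l + l * θ) with hF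
  have hFD : F * (1 - l + l * θ) = (1 - l) * θ := div_mul_cancel₀ _ hD.ne'
  have hF0 : 0 ≤ F := by positivity
  have hFq : F < 1 - l := by
    rw [hF, div_lt_iff₀ hD]
    nlinarith [mul_pos (mul_pos hq hq) (sub_pos.2 hθ1)]
  have hFθ : (1 - l) * θ ≤ F := by
    rw [hF, le_div_iff₀ hD]
    nlinarith [mul_nonneg (mul_nonneg hq.le hθ0) (mul_nonneg hl (sub_nonneg.2 hθ1.le))]
  set p := expect π g with hp
  have hp0 : 0 ≤ p := expect_nonneg hπ.1 hg0
  have hp1 : p ≤ 1 := by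
    have := expect_mono hπ.1 hg1
    rwa [expect_const hπ.1] at this
  have hpF : p * F ≤ F := mul_le_of_le_one_left hF0 hp1
  have hd0 : ∀ x, 0 ≤ 1 - θ * g x := fun x => by
    nlinarith [hg0 x, hg1 x]
  have hρ : ∀ x, l * (1 - θ * g x) < 1 - p * F := fun x => by
    have : 0 ≤ l * (θ * g x) := mul_nonneg hl (mul_nonneg hθ0 (hg0 x))
    linarith
  have hA : 0 < 1 - p * F - l := by linarith
  have hB : 0 < 1 - p * F - l + l * θ := by positivity
  have hE : expect π (fun x => (1 - l) * (1 - θ * g x) / (1 - p * F - l * (1 - θ * g x))) ≤ 1 := by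
    -- The chord in g reduces the expectation to its worst case, a {0, 1}-valued g of mean p.
    have hpt : ∀ x, (1 - l) * (1 - θ * g x) / (1 - p * F - l * (1 - θ * g x)) ≤
        (1 - l) / (1 - p * F - l) + ((1 - l) * (1 - θ) / (1 - p * F - l + l * θ) -
          (1 - l) / (1 - p * F - l)) * g x := fun x => by
      have := chord_le (n₀ := 1 - l) (n₁ := (1 - l) * (1 - θ)) hA
        (B := 1 - p * F - l + l * θ) (le_add_of_nonneg_right (mul_nonneg hl hθ0))
        (mul_nonneg hq.le (sub_nonneg.2 hθ1.le)) (mul_le_of_le_one_right hq.le (by linarith))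
        (hg0 x) (hg1 x)
      calc _ = ((1 - g x) * (1 - l) + g x * ((1 - l) * (1 - θ))) /
            ((1 - g x) * (1 - p * F - l) + g x * (1 - p * F - l + l * θ)) := by
              congr 1 <;> ring
        _ ≤ _ := this
        _ = _ := by ring
    refine (expect_mono hπ.1 hpt).trans ?_
    rw [expect_add, expect_const hπ.1, expect_const_mul, ← hp]
    have h1 : (1 - l) / (1 - p * F - l) + ((1 - l) * (1 - θ) / (1 - p * F - l + l * θ) -
          (1 - l) / (1 - p * F - l)) * p = ((1 - p) * (1 - l) * (1 - p * F - l + l * θ) +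
          p * (1 - l) * (1 - θ) * (1 - p * F - l)) /
          ((1 - p * F - l) * (1 - p * F - l + l * θ)) := by
      field_simp
      ring
    rw [h1, div_le_one (mul_pos hA hB)]
    have h2 : 0 ≤ p ^ 2 * F * (F - (1 - l) * θ) :=
      mul_nonneg (mul_nonneg (sq_nonneg _) hF0) (sub_nonneg.2 hFθ)
    linear_combination h2 + p * hFD
  refine (expect_mul_iterate_tilt_le hM hπ hl hl1.le (by linarith) hc hd0 hρ hE k).trans ?_
  rw [← mul_neg, Real.exp_nat_mul]
  refine pow_le_pow_left₀ (by linarith) ?_ _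
  calc 1 - p * F ≤ Real.exp (-(p * F)) := Real.one_sub_le_exp_neg _
    _ ≤ _ := Real.exp_le_exp.2 (neg_le_neg (mul_le_mul_of_nonneg_left hrate hp0))

end LowerTail

/-! ### Path sums over stationary traces -/

section Traces

variable {Ω : Type*} [Fintype Ω]

omit [Fintype Ω] in
lemma traceProb_snoc (M : Matrix Ω Ω ℝ) (π : Ω → ℝ) {k : ℕ} (w : Fin (k + 1) → Ω) (x : Ω) :
    traceProb M π (Fin.snoc w x : Fin (k + 2) → Ω) =
      traceProb M π w * M (w (Fin.last k)) x := by
  rw [traceProb, Fin.prod_univ_castSucc]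
  congr 1
  · refine Finset.prod_congr rfl fun i _ => ?_
    have h : (⟨(i : ℕ) - 1, by omega⟩ : Fin (k + 2)) =
        Fin.castSucc (⟨(i : ℕ) - 1, by omega⟩ : Fin (k + 1)) := rfl
    simp only [Fin.val_castSucc, Fin.snoc_castSucc, h]
  · have h : (⟨(k + 1) - 1, by omega⟩ : Fin (k + 2)) = Fin.castSucc (Fin.last k) := rfl
    simp only [Fin.val_last, Nat.add_one_ne_zero, if_false, Fin.snoc_last, h, Fin.snoc_castSucc]

lemma traceProb_nonneg [DecidableEq Ω]
    {M : Matrix Ω Ω ℝ} (hM : M ∈ Matrix.rowStochastic ℝ Ω) {π : Ω → ℝ}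
    (hπ : π ∈ stdSimplex ℝ Ω) {m : ℕ} (w : Fin m → Ω) : 0 ≤ traceProb M π w := by
  refine Finset.prod_nonneg fun i _ => ?_
  split_ifs
  · exact hπ.1 _
  · exact hM.1 _ _

lemma sum_snoc {k : ℕ} (G : (Fin (k + 1) → Ω) → ℝ) :
    ∑ w, G w = ∑ w : Fin k → Ω, ∑ x, G (Fin.snoc w x) := by
  rw [← (Fin.snocEquiv fun _ : Fin (k + 1) => Ω).sum_comp, Fintype.sum_prod_type,
    Finset.sum_comm]
  rfl

/-- The terminal function h is arbitrary so that summing out the last letter replaces h by its tilt.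
A word of k + 1 letters has k transitions, hence k tilts. -/
lemma sum_traceProb_mul_prod (M : Matrix Ω Ω ℝ) (π d : Ω → ℝ) (k : ℕ) (h : Ω → ℝ) :
    ∑ w : Fin (k + 1) → Ω, traceProb M π w * (∏ i, d (w i)) * h (w (Fin.last k)) =
      expect π (fun x => d x * (tilt M d)^[k] h x) := by
  induction k generalizing h with
  | zero =>
    rw [← (Equiv.funUnique (Fin 1) Ω).symm.sum_comp]
    simp [traceProb, expect, mul_assoc]
  | succ k ih =>
    rw [sum_snoc, Function.iterate_succ, Function.comp_apply, ← ih]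
    refine Finset.sum_congr rfl fun w _ => ?_
    simp only [tilt, Matrix.mulVec, dotProduct, Finset.mul_sum]
    refine Finset.sum_congr rfl fun x _ => ?_
    rw [traceProb_snoc, Fin.prod_univ_castSucc]
    simp only [Fin.snoc_castSucc, Fin.snoc_last]
    ring

lemma sum_traceProb_mul_eval [DecidableEq Ω]
    {M : Matrix Ω Ω ℝ} (hM : M ∈ Matrix.rowStochastic ℝ Ω) {π : Ω → ℝ}
    (hπ : IsStationaryDist M π) (g : Ω → ℝ) {m : ℕ} (i : Fin m) :
    ∑ w : Fin m → Ω, traceProb M π w * g (w i) = expect π g := by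
  cases m with
  | zero => exact i.elim0
  | succ k =>
  induction k with
  | zero =>
    rw [Fin.fin_one_eq_zero i, ← (Equiv.funUnique (Fin 1) Ω).symm.sum_comp]
    simp [traceProb, expect]
  | succ k ih =>
    refine Fin.lastCases ?_ (fun i => ?_) i
    · have h := sum_traceProb_mul_prod M π (fun _ => 1) (k + 1) g
      simp only [Finset.prod_const_one, mul_one, one_mul] at h
      rw [h]
      have : ∀ n (g : Ω → ℝ), expect π (fun x => (tilt M fun _ => 1)^[n] g x) = expect π g := by
        intro n
        induction n with
        | zero => intro g; rfl
        | succ n ihn =>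
          intro g
          rw [Function.iterate_succ, Function.comp_apply, ihn, ← expect_mulVec hπ g]
          simp [tilt]
      exact this _ g
    · rw [sum_snoc, ← ih i]
      refine Finset.sum_congr rfl fun w _ => ?_
      simp only [traceProb_snoc, Fin.snoc_castSucc]
      rw [← Finset.sum_mul, ← Finset.mul_sum, Matrix.sum_row_of_mem_rowStochastic hM, mul_one]

lemma sum_traceProb_mul_exp_le [DecidableEq Ω]
    {M : Matrix Ω Ω ℝ} (hM : M ∈ Matrix.rowStochastic ℝ Ω)
    {π : Ω → ℝ} (hπ : IsStationaryDist M π) {l : ℝ} (hl : 0 ≤ l) (hl1 : l < 1)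
    (hc : ContractsMeanZero M π l) {g : Ω → ℝ} (hg0 : ∀ x, 0 ≤ g x) (hg1 : ∀ x, g x ≤ 1)
    {t : ℝ} (ht : 0 ≤ t) {m : ℕ} (hm : 1 ≤ m) :
    ∑ w : Fin m → Ω, traceProb M π w * Real.exp (-t * ∑ i, g (w i)) ≤
      Real.exp (-(m * (expect π g * (t - (1 + l) / (1 - l) * t ^ 2 / 2)))) := by
  obtain ⟨k, rfl⟩ := Nat.exists_eq_add_of_le' hm
  refine le_trans ?_ (expect_mul_iterate_tilt_le_exp hM hπ hl hl1 hc hg0 hg1 ht k)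
  rw [← sum_traceProb_mul_prod]
  refine Finset.sum_le_sum fun w _ => ?_
  rw [mul_one, Finset.mul_sum, Real.exp_sum]
  refine mul_le_mul_of_nonneg_left ?_ (traceProb_nonneg hM hπ.1 w)
  exact Finset.prod_le_prod (fun i _ => (Real.exp_pos _).le)
    fun i _ => exp_neg_mul_le (hg0 _) (hg1 _)

end Traces

/-! ### The product of two independent chains -/

section Pairs

variable {Ω : Type*} [Fintype Ω]

/-- The transition matrix of two independent copies of a chain. -/
def pairMatrix (M : Matrix Ω Ω ℝ) : Matrix (Ω × Ω) (Ω × Ω) ℝ :=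
  fun p q => M p.1 q.1 * M p.2 q.2

/-- The product distribution. -/
def pairDist (π : Ω → ℝ) (p : Ω × Ω) : ℝ :=
  π p.1 * π p.2

lemma expect_pairDist (π : Ω → ℝ) (h : Ω × Ω → ℝ) :
    expect (pairDist π) h = expect π (fun x => expect π (fun y => h (x, y))) := by
  simp only [expect, pairDist, Fintype.sum_prod_type, Finset.mul_sum, mul_assoc]

lemma expect_comm (π : Ω → ℝ) (h : Ω → Ω → ℝ) :
    expect π (fun x => expect π (fun y => h x y)) =
      expect π (fun y => expect π (fun x => h x y)) := by
  simp only [expect, Finset.mul_sum]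
  rw [Finset.sum_comm]
  exact Finset.sum_congr rfl fun _ _ => Finset.sum_congr rfl fun _ _ => mul_left_comm _ _ _

lemma pairMatrix_mulVec (M : Matrix Ω Ω ℝ) (h : Ω × Ω → ℝ) (x y : Ω) :
    (pairMatrix M).mulVec h (x, y) =
      M.mulVec (fun x' => M.mulVec (fun y' => h (x', y')) y) x := by
  simp only [Matrix.mulVec, dotProduct, pairMatrix, Fintype.sum_prod_type, Finset.mul_sum,
    mul_assoc]

lemma expect_mulVec_comm (M : Matrix Ω Ω ℝ) (π : Ω → ℝ) (h : Ω → Ω → ℝ) (x : Ω) :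
    expect π (fun y => M.mulVec (fun x' => h x' y) x) =
      M.mulVec (fun x' => expect π (fun y => h x' y)) x := by
  simp only [expect, Matrix.mulVec, dotProduct, Finset.mul_sum]
  rw [Finset.sum_comm]
  exact Finset.sum_congr rfl fun _ _ => Finset.sum_congr rfl fun _ _ => mul_left_comm _ _ _

lemma pairMatrix_mem_rowStochastic [DecidableEq Ω]
    {M : Matrix Ω Ω ℝ} (hM : M ∈ Matrix.rowStochastic ℝ Ω) :
    pairMatrix M ∈ Matrix.rowStochastic ℝ (Ω × Ω) := by
  rw [Matrix.mem_rowStochastic_iff_sum]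
  refine ⟨fun p q => mul_nonneg (hM.1 _ _) (hM.1 _ _), fun p => ?_⟩
  simp only [pairMatrix, Fintype.sum_prod_type, ← Finset.mul_sum,
    Matrix.sum_row_of_mem_rowStochastic hM, mul_one]

lemma isStationaryDist_pair {M : Matrix Ω Ω ℝ} {π : Ω → ℝ} (hπ : IsStationaryDist M π) :
    IsStationaryDist (pairMatrix M) (pairDist π) := by
  refine ⟨⟨fun p => mul_nonneg (hπ.1.1 _) (hπ.1.1 _), ?_⟩, ?_⟩
  · simp only [pairDist, Fintype.sum_prod_type, ← Finset.mul_sum, hπ.1.2, mul_one]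
  · ext ⟨x, y⟩
    have h : ∀ z, ∑ x, π x * M x z = π z := fun z => congrFun hπ.2 z
    simp only [Matrix.vecMul, dotProduct, pairDist, pairMatrix, Fintype.sum_prod_type]
    rw [← h x, ← h y, Finset.sum_mul_sum]
    exact Finset.sum_congr rfl fun _ _ => Finset.sum_congr rfl fun _ _ => mul_mul_mul_comm _ _ _ _

/-- Decompose h into its average u over the second coordinate and a remainder k with mean zero in
that coordinate; both the pieces and their images are orthogonal. On u the first copy of M
contracts. On k the second copy contracts, and the first does not increase the norm. -/
lemma ContractsMeanZero.pair [DecidableEq Ω]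
    {M : Matrix Ω Ω ℝ} (hM : M ∈ Matrix.rowStochastic ℝ Ω) {π : Ω → ℝ}
    (hπ : IsStationaryDist M π) {l : ℝ} (hc : ContractsMeanZero M π l) :
    ContractsMeanZero (pairMatrix M) (pairDist π) l := by
  intro h hh
  rw [expect_pairDist] at hh
  set u : Ω → ℝ := fun x => expect π (fun y => h (x, y)) with hu
  set k : Ω → Ω → ℝ := fun x y => h (x, y) - u x with hk
  set r : Ω → Ω → ℝ := fun x' y => M.mulVec (k x') y with hr
  set s : Ω → Ω → ℝ := fun x y => M.mulVec (fun x' => r x' y) x with hs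
  have hk0 : ∀ x, expect π (k x) = 0 := fun x => by
    rw [hk, expect_sub, expect_const hπ.1, sub_self]
  have hr0 : ∀ x, expect π (r x) = 0 := fun x => (expect_mulVec hπ _).trans (hk0 x)
  have hs0 : ∀ x, expect π (s x) = 0 := fun x => by
    rw [hs, expect_mulVec_comm]
    simp only [hr0]
    simp [Matrix.mulVec, dotProduct]
  have hM2 : ∀ x y, (pairMatrix M).mulVec h (x, y) = M.mulVec u x + s x y := fun x y => by
    have h1 : ∀ x', M.mulVec (fun y' => h (x', y')) y = u x' + r x' y := fun x' => by
      have : (fun y' => h (x', y')) = (fun _ => u x') + k x' := by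
        ext y'; simp [hk]
      rw [this, Matrix.mulVec_add, mulVec_const hM]
      rfl
    rw [pairMatrix_mulVec, hs]
    simp only [h1]
    exact congrFun (Matrix.mulVec_add M u fun x' => r x' y) x
  have pyth : ∀ (c : ℝ) (v : Ω → ℝ), expect π v = 0 →
      expect π (fun y => (c + v y) ^ 2) = c ^ 2 + expect π (fun y => v y ^ 2) := fun c v hv => by
    have : (fun y => (c + v y) ^ 2) = fun y => (c ^ 2 + 2 * c * v y) + v y ^ 2 := by
      ext y; ring
    rw [this, expect_add, expect_add, expect_const hπ.1, expect_const_mul, hv]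
    ring
  have hL : expect (pairDist π) (fun p => (pairMatrix M).mulVec h p ^ 2) =
      expect π (fun x => M.mulVec u x ^ 2) +
        expect π (fun x => expect π (fun y => s x y ^ 2)) := by
    rw [expect_pairDist]
    simp only [hM2]
    simp only [fun x => pyth (M.mulVec u x) (s x) (hs0 x)]
    rw [expect_add]
  have hR : expect (pairDist π) (fun p => h p ^ 2) =
      expect π (fun x => u x ^ 2) + expect π (fun x => expect π (fun y => k x y ^ 2)) := by
    rw [expect_pairDist]
    have h1 : ∀ x y, h (x, y) = u x + k x y := fun x y => by simp [hk]
    simp only [h1]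
    simp only [fun x => pyth (u x) (k x) (hk0 x)]
    rw [expect_add]
  have h2 : expect π (fun x => expect π (fun y => s x y ^ 2)) ≤
      l ^ 2 * expect π (fun x => expect π (fun y => k x y ^ 2)) := by
    rw [expect_comm, ← expect_const_mul]
    calc _ ≤ expect π (fun y => expect π (fun x => r x y ^ 2)) :=
          expect_mono hπ.1 fun y => expect_sq_mulVec_le hM hπ _
      _ = expect π (fun x => expect π (fun y => r x y ^ 2)) := expect_comm _ _
      _ ≤ _ := expect_mono hπ.1 fun x => hc (k x) (hk0 x)
  rw [hL, hR, mul_add]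
  exact add_le_add (hc u hh) h2

omit [Fintype Ω] in
lemma traceProb_pair (M : Matrix Ω Ω ℝ) (π : Ω → ℝ) {m : ℕ} (w₁ w₂ : Fin m → Ω) :
    traceProb (pairMatrix M) (pairDist π) (fun i => (w₁ i, w₂ i)) =
      traceProb M π w₁ * traceProb M π w₂ := by
  rw [traceProb, traceProb, traceProb, ← Finset.prod_mul_distrib]
  refine Finset.prod_congr rfl fun i _ => ?_
  split_ifs <;> rfl

end Pairs

/-! ### Harmonic functions and positivity of the stationary law -/

section Irreducible

variable {Ω : Type*} [Fintype Ω] [DecidableEq Ω] {M : Matrix Ω Ω ℝ} {π : Ω → ℝ}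

omit [DecidableEq Ω] in
lemma nonempty_of_mem_stdSimplex (hπ : π ∈ stdSimplex ℝ Ω) : Nonempty Ω := by
  by_contra h
  rw [not_nonempty_iff] at h
  simpa using hπ.2

lemma pow_mulVec_eq_self {h : Ω → ℝ} (hh : M.mulVec h = h) (k : ℕ) : (M ^ k).mulVec h = h := by
  induction k with
  | zero => simp
  | succ k ih => rw [pow_succ, ← Matrix.mulVec_mulVec, hh, ih]

/-- A harmonic function of an irreducible chain is constant. -/
lemma eq_const_of_mulVec_eq_self [Nonempty Ω] (hM : M ∈ Matrix.rowStochastic ℝ Ω)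
    (hirr : M.IsIrreducible) {h : Ω → ℝ} (hh : M.mulVec h = h) : ∃ c, h = fun _ => c := by
  obtain ⟨x, hx⟩ := Finite.exists_max h
  refine ⟨h x, funext fun y => ?_⟩
  obtain ⟨k, -, hk⟩ := (Matrix.isIrreducible_iff_exists_pow_pos hirr.1).1 hirr x y
  have hMk := Submonoid.pow_mem _ hM k
  -- Maximum principle: x maximises h, so every term is nonnegative and hence zero.
  have hsum : ∑ z, (M ^ k) x z * (h x - h z) = 0 := by
    have h1 : ∑ z, (M ^ k) x z * h z = h x := congrFun (pow_mulVec_eq_self hh k) x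
    simp only [mul_sub, Finset.sum_sub_distrib, ← Finset.sum_mul, h1,
      Matrix.sum_row_of_mem_rowStochastic hMk, one_mul, sub_self]
  have h2 := (Finset.sum_eq_zero_iff_of_nonneg fun z _ =>
    mul_nonneg (hMk.1 x z) (sub_nonneg.2 (hx z))).1 hsum y (Finset.mem_univ y)
  have h3 := (mul_eq_zero.1 h2).resolve_left hk.ne'
  linarith

lemma eq_zero_of_mulVec_eq_self (hM : M ∈ Matrix.rowStochastic ℝ Ω) (hirr : M.IsIrreducible)
    (hπ : π ∈ stdSimplex ℝ Ω) {h : Ω → ℝ} (hh : M.mulVec h = h) (h0 : expect π h = 0) :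
    h = 0 := by
  have := nonempty_of_mem_stdSimplex hπ
  obtain ⟨c, rfl⟩ := eq_const_of_mulVec_eq_self hM hirr hh
  rw [expect_const hπ] at h0
  rw [h0]
  rfl

lemma stationary_pos (hM : M ∈ Matrix.rowStochastic ℝ Ω) (hirr : M.IsIrreducible)
    (hπ : IsStationaryDist M π) (y : Ω) : 0 < π y := by
  obtain ⟨x, hx⟩ : ∃ x, 0 < π x := by
    by_contra! h
    have h1 := hπ.1.2
    have h2 : ∑ x, π x ≤ 0 := Finset.sum_nonpos fun x _ => h x
    linarith
  obtain ⟨k, -, hk⟩ := (Matrix.isIrreducible_iff_exists_pow_pos hirr.1).1 hirr x y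
  have hπk : ∀ k, Matrix.vecMul π (M ^ k) = π := fun k => by
    induction k with
    | zero => simp
    | succ k ih => rw [pow_succ, ← Matrix.vecMul_vecMul, ih, hπ.2]
  rw [← hπk k]
  exact Finset.sum_pos' (fun z _ => mul_nonneg (hπ.1.1 z) ((Submonoid.pow_mem _ hM k).1 z y))
    ⟨x, Finset.mem_univ x, mul_pos hx hk⟩

omit [DecidableEq Ω] in
lemma eq_zero_of_expect_sq_le {h : Ω → ℝ} (hpos : ∀ x, 0 < π x)
    (hh : expect π (fun x => h x ^ 2) ≤ 0) : h = 0 := by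
  have hnn : ∀ x, 0 ≤ π x * h x ^ 2 := fun x => mul_nonneg (hpos x).le (sq_nonneg _)
  have h1 := (Finset.sum_eq_zero_iff_of_nonneg fun x _ => hnn x).1
    (le_antisymm hh (Finset.sum_nonneg fun x _ => hnn x))
  ext x
  have := h1 x (Finset.mem_univ x)
  simpa [(hpos x).ne'] using this

end Irreducible

/-! ### The L² contraction constant and lazy chains -/

section Gap

variable {Ω : Type*} [Fintype Ω] {M : Matrix Ω Ω ℝ} {π : Ω → ℝ}

lemma l2Norm_eq (π h : Ω → ℝ) : l2Norm π h = √(expect π fun x => h x ^ 2) := rfl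

lemma sq_l2Norm (hπ : π ∈ stdSimplex ℝ Ω) (h : Ω → ℝ) :
    l2Norm π h ^ 2 = expect π fun x => h x ^ 2 :=
  Real.sq_sqrt (expect_nonneg hπ fun _ => sq_nonneg _)

lemma l2Contraction_nonneg (M : Matrix Ω Ω ℝ) (π : Ω → ℝ) : 0 ≤ l2Contraction M π :=
  Real.sSup_nonneg fun _ ⟨_, _, _, hr⟩ => hr ▸ Real.sqrt_nonneg _

variable [DecidableEq Ω]

lemma l2Norm_mulVec_le_l2Contraction (hM : M ∈ Matrix.rowStochastic ℝ Ω)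
    (hπ : IsStationaryDist M π) {h : Ω → ℝ} (h0 : expect π h = 0) (h1 : l2Norm π h ≤ 1) :
    l2Norm π (M.mulVec h) ≤ l2Contraction M π := by
  refine le_csSup ⟨1, ?_⟩ ⟨h, h0, h1, rfl⟩
  rintro r ⟨g, -, hg, rfl⟩
  exact (Real.sqrt_le_sqrt (expect_sq_mulVec_le hM hπ g)).trans hg

lemma contractsMeanZero_l2Contraction (hM : M ∈ Matrix.rowStochastic ℝ Ω)
    (hπ : IsStationaryDist M π) : ContractsMeanZero M π (l2Contraction M π) := by
  intro h h0
  have hle := expect_sq_mulVec_le hM hπ h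
  rcases (expect_nonneg hπ.1 fun x => sq_nonneg (h x)).eq_or_lt with hn | hn
  · rw [← hn] at hle ⊢
    simpa using hle
  set n := expect π (fun x => h x ^ 2) with hn_def
  have hc : (√n)⁻¹ ^ 2 * n = 1 := by
    rw [inv_pow, Real.sq_sqrt hn.le, inv_mul_cancel₀ hn.ne']
  have key := l2Norm_mulVec_le_l2Contraction hM hπ (h := fun x => (√n)⁻¹ * h x)
    (by rw [expect_const_mul, h0, mul_zero])
    (by simp only [l2Norm_eq, mul_pow, expect_const_mul, ← hn_def, hc, Real.sqrt_one, le_refl])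
  have hmul : M.mulVec (fun x => (√n)⁻¹ * h x) = fun x => (√n)⁻¹ * M.mulVec h x :=
    Matrix.mulVec_smul M (√n)⁻¹ h
  have h2 := pow_le_pow_left₀ (b := l2Contraction M π) (a := l2Norm π _)
    (Real.sqrt_nonneg _) key 2
  rw [sq_l2Norm hπ.1, hmul] at h2
  simp only [mul_pow, expect_const_mul] at h2
  rw [inv_pow, Real.sq_sqrt hn.le, inv_mul_le_iff₀ hn] at h2
  linarith

/-- Positivity of π makes the unit ball of L²(π) compact, so the supremum is attained. -/
lemma exists_l2Norm_mulVec_eq_l2Contraction (hM : M ∈ Matrix.rowStochastic ℝ Ω)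
    (hπ : IsStationaryDist M π) (hpos : ∀ x, 0 < π x) :
    ∃ h, expect π h = 0 ∧ expect π (fun x => h x ^ 2) ≤ 1 ∧
      expect π (fun x => M.mulVec h x ^ 2) = l2Contraction M π ^ 2 := by
  have hcont : ∀ N : Matrix Ω Ω ℝ, Continuous fun h : Ω → ℝ => l2Norm π (N.mulVec h) := fun N => by
    unfold l2Norm Matrix.mulVec dotProduct
    fun_prop
  have hclosed : IsClosed {h : Ω → ℝ | expect π h = 0 ∧ l2Norm π h ≤ 1} := by
    have h1 : Continuous fun h : Ω → ℝ => expect π h := by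
      unfold expect
      fun_prop
    have h2 : Continuous fun h : Ω → ℝ => l2Norm π h := by simpa using hcont 1
    exact (isClosed_eq h1 continuous_const).inter (isClosed_le h2 continuous_const)
  have hcompact : IsCompact {h : Ω → ℝ | expect π h = 0 ∧ l2Norm π h ≤ 1} := by
    refine (isCompact_univ_pi fun x => isCompact_Icc (a := -(1 / π x))
      (b := 1 / π x)).of_isClosed_subset hclosed ?_
    rintro h ⟨-, h1⟩ x -
    refine abs_le.1 (abs_le_of_sq_le_sq ?_ (one_div_pos.2 (hpos x)).le)
    have h2 : expect π (fun x => h x ^ 2) ≤ 1 := Real.sqrt_le_one.1 h1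
    have h3 : π x * h x ^ 2 ≤ 1 := (Finset.single_le_sum
      (f := fun x => π x * h x ^ 2) (fun y _ => mul_nonneg (hpos y).le (sq_nonneg _))
      (Finset.mem_univ x)).trans h2
    have h4 : π x ≤ 1 := hπ.1.2 ▸ Finset.single_le_sum (fun y _ => hπ.1.1 y) (Finset.mem_univ x)
    rw [div_pow, one_pow, le_div_iff₀ (pow_pos (hpos x) 2)]
    nlinarith [hpos x]
  have hzero : (0 : Ω → ℝ) ∈ {h : Ω → ℝ | expect π h = 0 ∧ l2Norm π h ≤ 1} := by
    simp [expect, l2Norm]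
  obtain ⟨h, ⟨h0, h1⟩, hmax⟩ := hcompact.exists_isMaxOn ⟨0, hzero⟩ (hcont M).continuousOn
  refine ⟨h, h0, Real.sqrt_le_one.1 h1, ?_⟩
  rw [← sq_l2Norm hπ.1]
  congr 1
  refine le_antisymm (l2Norm_mulVec_le_l2Contraction hM hπ h0 h1)
    (csSup_le ⟨_, 0, hzero.1, hzero.2, rfl⟩ ?_)
  rintro r ⟨g, hg0, hg1, rfl⟩
  exact hmax ⟨hg0, hg1⟩

/-- For a lazy chain, `‖M h‖² ≤ ⟨h, M h⟩`. -/
lemma expect_sq_mulVec_le_of_isLazy (hM : M ∈ Matrix.rowStochastic ℝ Ω)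
    (hπ : IsStationaryDist M π) (hlazy : IsLazy M) (h : Ω → ℝ) :
    expect π (fun x => M.mulVec h x ^ 2) ≤ expect π (fun x => h x * M.mulVec h x) := by
  -- Laziness is nonnegativity of the diagonal of 2M - I; expanding ‖(2M - I) h‖² ≤ ‖h‖² gives the
  -- claim.
  have hQ : (2 : ℝ) • M - 1 ∈ Matrix.rowStochastic ℝ Ω := by
    rw [Matrix.mem_rowStochastic_iff_sum]
    refine ⟨fun x y => ?_, fun x => ?_⟩
    · rcases eq_or_ne x y with rfl | hxy
      · have := hlazy x
        simp only [Matrix.sub_apply, Matrix.smul_apply, smul_eq_mul, Matrix.one_apply_eq]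
        linarith
      · simpa [hxy] using hM.1 x y
    · simp only [Matrix.sub_apply, Matrix.smul_apply, smul_eq_mul, Finset.sum_sub_distrib,
        ← Finset.mul_sum, Matrix.sum_row_of_mem_rowStochastic hM]
      simp [Matrix.one_apply]
      norm_num
  have hQπ : IsStationaryDist ((2 : ℝ) • M - 1) π := by
    refine ⟨hπ.1, ?_⟩
    rw [Matrix.vecMul_sub, Matrix.vecMul_smul, hπ.2, Matrix.vecMul_one, two_smul,
      add_sub_cancel_right]
  have h1 := expect_sq_mulVec_le hQ hQπ h
  have h2 : (fun x => ((2 : ℝ) • M - 1).mulVec h x ^ 2) = fun x =>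
      (4 * M.mulVec h x ^ 2 - 4 * (h x * M.mulVec h x)) + h x ^ 2 := by
    ext x
    rw [Matrix.sub_mulVec, Matrix.smul_mulVec, Matrix.one_mulVec]
    simp only [Pi.sub_apply, Pi.smul_apply, smul_eq_mul]
    ring
  rw [h2, expect_add, expect_sub, expect_const_mul, expect_const_mul] at h1
  linarith

lemma l2Contraction_lt_one_of_isLazy (hM : M ∈ Matrix.rowStochastic ℝ Ω)
    (hπ : IsStationaryDist M π) (hirr : M.IsIrreducible) (hlazy : IsLazy M) :
    l2Contraction M π < 1 := by
  have hpos := stationary_pos hM hirr hπ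
  obtain ⟨h, h0, h1, hl⟩ := exists_l2Norm_mulVec_eq_l2Contraction hM hπ hpos
  by_contra! hge
  have hge2 : 1 ≤ l2Contraction M π ^ 2 := one_le_pow₀ hge
  have h2 := expect_sq_mulVec_le_of_isLazy hM hπ hlazy h
  have h3 : (fun x => (h x - M.mulVec h x) ^ 2) = fun x =>
      (h x ^ 2 - 2 * (h x * M.mulVec h x)) + M.mulVec h x ^ 2 := by
    ext x; ring
  -- If λ_* ≥ 1, then ‖h - M h‖² ≤ ‖h‖² - ‖M h‖² ≤ 0 for the maximiser h, which is thus harmonic of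
  -- mean zero.
  have h4 : (fun x => h x - M.mulVec h x) = 0 := by
    refine eq_zero_of_expect_sq_le hpos ?_
    rw [h3, expect_add, expect_sub, expect_const_mul]
    linarith
  have h5 : M.mulVec h = h := funext fun x => (sub_eq_zero.1 (congrFun h4 x)).symm
  have h6 := eq_zero_of_mulVec_eq_self hM hirr hπ.1 h5 h0
  rw [← hl, h6] at hge2
  simp [expect] at hge2
  linarith

end Gap

/-! ### The second eigenvalue of ergodic and reversible chains -/

section SecondEigenvalue

variable {Ω : Type*} [Fintype Ω] [DecidableEq Ω] {M : Matrix Ω Ω ℝ} {π : Ω → ℝ}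

lemma pow_add_apply_pos (hM : M ∈ Matrix.rowStochastic ℝ Ω) {j k : ℕ} {x y z : Ω}
    (h1 : 0 < (M ^ j) x y) (h2 : 0 < (M ^ k) y z) : 0 < (M ^ (j + k)) x z := by
  rw [pow_add, Matrix.mul_apply]
  exact Finset.sum_pos' (fun w _ => mul_nonneg ((Submonoid.pow_mem _ hM j).1 x w)
    ((Submonoid.pow_mem _ hM k).1 w z)) ⟨y, Finset.mem_univ y, mul_pos h1 h2⟩

/-- Return times are closed under addition and have gcd 1, so they include all large integers. -/
lemma exists_forall_ge_return_pos (hM : M ∈ Matrix.rowStochastic ℝ Ω) (hap : IsAperiodic M)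
    (x : Ω) : ∃ n, ∀ k ≥ n, 0 < (M ^ k) x x := by
  obtain ⟨n, hn⟩ := Nat.exists_mem_closure_of_ge {k : ℕ | 1 ≤ k ∧ 0 < (M ^ k) x x}
  have hg : Nat.setGcd {k : ℕ | 1 ≤ k ∧ 0 < (M ^ k) x x} = 1 :=
    hap x _ fun k hk1 hk2 => Nat.setGcd_dvd_of_mem ⟨hk1, hk2⟩
  refine ⟨n, fun k hk => ?_⟩
  refine AddSubmonoid.closure_induction (motive := fun k _ => 0 < (M ^ k) x x)
    (fun k hk => hk.2) (by simp) (fun j k _ _ => pow_add_apply_pos hM)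
    (hn k hk (by rw [hg]; exact one_dvd k))

lemma IsErgodicChain.exists_pow_pos (hM : M ∈ Matrix.rowStochastic ℝ Ω) (h : IsErgodicChain M) :
    ∃ N, 0 < N ∧ ∀ x y, 0 < (M ^ N) x y := by
  choose n hn using exists_forall_ge_return_pos hM h.2
  choose k _ hk using (Matrix.isIrreducible_iff_exists_pow_pos h.1.1).1 h.1
  refine ⟨(∑ x, n x) + (∑ x, ∑ y, k x y) + 1, by omega, fun x y => ?_⟩
  have h1 : n x ≤ ∑ x, n x := Finset.single_le_sum (fun _ _ => Nat.zero_le _) (Finset.mem_univ x)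
  have h2 : k x y ≤ ∑ x, ∑ y, k x y :=
    (Finset.single_le_sum (f := k x) (fun _ _ => Nat.zero_le _) (Finset.mem_univ y)).trans
      (Finset.single_le_sum (f := fun x => ∑ y, k x y) (fun _ _ => Nat.zero_le _)
        (Finset.mem_univ x))
  have h3 := pow_add_apply_pos hM
    (hn x ((∑ x, n x) + (∑ x, ∑ y, k x y) + 1 - k x y) (by omega)) (hk x y)
  rwa [Nat.sub_add_cancel (by omega)] at h3

/-- Doeblin's argument: an eigenvector u for γ ≠ 1 satisfies ∑ π u = 0, so subtracting ε π from each
row of a positive power M ^ N leaves γ ^ N u unchanged. The reduced rows are nonnegative with sum 1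
- ε; compare at the maximum of |u|. -/
lemma norm_lt_one_of_hasEigenvalue (hM : M ∈ Matrix.rowStochastic ℝ Ω)
    (hπ : IsStationaryDist M π) (herg : IsErgodicChain M) {γ : ℂ}
    (hγ : Module.End.HasEigenvalue (Matrix.toLin' (M.map Complex.ofReal)) γ) (hγ1 : γ ≠ 1) :
    ‖γ‖ < 1 := by
  have := nonempty_of_mem_stdSimplex hπ.1
  obtain ⟨u, hu⟩ := hγ.exists_hasEigenvector
  have hu1 : ∀ x, ∑ y, (M x y : ℂ) * u y = γ * u x := fun x => by
    have := congrFun hu.apply_eq_smul x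
    simpa [Matrix.toLin'_apply, Matrix.mulVec, dotProduct] using this
  obtain ⟨N, hN, hpos⟩ := herg.exists_pow_pos hM
  have hMN := Submonoid.pow_mem _ hM N
  have huN : ∀ n x, ∑ y, ((M ^ n) x y : ℂ) * u y = γ ^ n * u x := fun n => by
    induction n with
    | zero => intro x; simp [Matrix.one_apply, apply_ite Complex.ofReal]
    | succ n ih =>
      intro x
      simp only [pow_succ, Matrix.mul_apply, Complex.ofReal_sum, Complex.ofReal_mul,
        Finset.sum_mul]
      rw [Finset.sum_comm]
      simp only [mul_assoc, ← Finset.mul_sum, hu1]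
      simp only [mul_left_comm _ γ, ← Finset.mul_sum, ih]
  have hπu : ∑ x, (π x : ℂ) * u x = 0 := by
    have hstat : ∀ y, ∑ x, (π x : ℂ) * (M x y : ℂ) = π y := fun y => by
      have : ∑ x, π x * M x y = π y := congrFun hπ.2 y
      rw [← this]
      push_cast
      rfl
    have h1 : ∑ x, (π x : ℂ) * u x = γ * ∑ x, (π x : ℂ) * u x := by
      calc ∑ y, (π y : ℂ) * u y = ∑ y, ∑ x, (π x : ℂ) * (M x y : ℂ) * u y := by
            simp only [← Finset.sum_mul, hstat]
        _ = ∑ x, (π x : ℂ) * ∑ y, (M x y : ℂ) * u y := by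
            rw [Finset.sum_comm]
            simp only [Finset.mul_sum, mul_assoc]
        _ = _ := by
            simp only [hu1, Finset.mul_sum, mul_left_comm]
    have h2 : (1 - γ) * ∑ x, (π x : ℂ) * u x = 0 := by
      rw [sub_mul, one_mul, ← h1, sub_self]
    exact (mul_eq_zero.1 h2).resolve_left (sub_ne_zero.2 hγ1.symm)
  obtain ⟨⟨x₀, y₀⟩, hmin⟩ := Finite.exists_min fun p : Ω × Ω => (M ^ N) p.1 p.2
  set ε := (M ^ N) x₀ y₀ with hε
  have hε0 : 0 < ε := hpos x₀ y₀
  have hle : ∀ x y, 0 ≤ (M ^ N) x y - ε * π y := fun x y => by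
    have h4 : π y ≤ 1 := hπ.1.2 ▸ Finset.single_le_sum (fun y _ => hπ.1.1 y) (Finset.mem_univ y)
    have h5 : ε ≤ (M ^ N) x y := hmin (x, y)
    nlinarith
  obtain ⟨x, hx⟩ := Finite.exists_max fun x => ‖u x‖
  have hux : 0 < ‖u x‖ := by
    by_contra! h
    exact hu.2 (funext fun y => norm_le_zero_iff.1 ((hx y).trans h))
  have hbound : ‖γ‖ ^ N * ‖u x‖ ≤ (1 - ε) * ‖u x‖ := by
    have h1 : γ ^ N * u x = ∑ y, (((M ^ N) x y - ε * π y : ℝ) : ℂ) * u y := by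
      push_cast
      simp only [sub_mul, Finset.sum_sub_distrib, huN, mul_assoc, ← Finset.mul_sum, hπu,
        mul_zero, sub_zero]
    rw [← norm_pow, ← norm_mul, h1]
    calc _ ≤ ∑ y, ‖(((M ^ N) x y - ε * π y : ℝ) : ℂ) * u y‖ := norm_sum_le _ _
      _ ≤ ∑ y, ((M ^ N) x y - ε * π y) * ‖u x‖ := by
        refine Finset.sum_le_sum fun y _ => ?_
        rw [norm_mul, Complex.norm_real, Real.norm_of_nonneg (hle x y)]
        exact mul_le_mul_of_nonneg_left (hx y) (hle x y)
      _ = (1 - ε) * ‖u x‖ := by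
        rw [← Finset.sum_mul, Finset.sum_sub_distrib, ← Finset.mul_sum, hπ.1.2, mul_one,
          Matrix.sum_row_of_mem_rowStochastic hMN]
  have h6 : ‖γ‖ ^ N < 1 := (le_of_mul_le_mul_right hbound hux).trans_lt (sub_lt_self _ hε0)
  exact (pow_lt_one_iff_of_nonneg (norm_nonneg _) hN.ne').1 h6

lemma secondEigenvalue_nonneg (M : Matrix Ω Ω ℝ) : 0 ≤ secondEigenvalue M :=
  Real.sSup_nonneg fun _ ⟨_, _, _, hr⟩ => hr ▸ norm_nonneg _

lemma finite_norm_eigenvalues (M : Matrix Ω Ω ℝ) : {r : ℝ | ∃ γ : ℂ,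
    Module.End.HasEigenvalue (Matrix.toLin' (M.map Complex.ofReal)) γ ∧ γ ≠ 1 ∧
      r = ‖γ‖}.Finite := by
  refine ((Module.End.finite_hasEigenvalue
    (Matrix.toLin' (M.map Complex.ofReal))).image norm).subset ?_
  rintro r ⟨γ, hγ, -, rfl⟩
  exact ⟨γ, hγ, rfl⟩

lemma secondEigenvalue_lt_one (hM : M ∈ Matrix.rowStochastic ℝ Ω)
    (hπ : IsStationaryDist M π) (herg : IsErgodicChain M) : secondEigenvalue M < 1 := by
  unfold secondEigenvalue
  rcases Set.eq_empty_or_nonempty {r : ℝ | ∃ γ : ℂ,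
    Module.End.HasEigenvalue (Matrix.toLin' (M.map Complex.ofReal)) γ ∧ γ ≠ 1 ∧
      r = ‖γ‖} with h | h
  · rw [h, Real.sSup_empty]
    exact one_pos
  · obtain ⟨γ, hγ, hγ1, hr⟩ := h.csSup_mem (finite_norm_eigenvalues M)
    rw [hr]
    exact norm_lt_one_of_hasEigenvalue hM hπ herg hγ hγ1

lemma abs_le_secondEigenvalue {c : ℝ} {k : Ω → ℝ} (hk : k ≠ 0) (hMk : M.mulVec k = c • k)
    (hc : c ≠ 1) : |c| ≤ secondEigenvalue M := by
  refine le_csSup (finite_norm_eigenvalues M).bddAbove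
    ⟨c, Module.End.hasEigenvalue_of_hasEigenvector (x := fun x => (k x : ℂ)) ⟨?_, ?_⟩,
      by exact_mod_cast hc, by simp⟩
  · rw [Module.End.mem_eigenspace_iff]
    ext x
    have h1 : ∑ y, M x y * k y = c * k x := congrFun hMk x
    have h2 : ∑ y, (M x y : ℂ) * (k y : ℂ) = (c : ℂ) * (k x : ℂ) := by exact_mod_cast h1
    simpa [Matrix.toLin'_apply, Matrix.mulVec, dotProduct] using h2
  · intro h
    exact hk (funext fun x => Complex.ofReal_eq_zero.1 (congrFun h x))

omit [DecidableEq Ω] in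
lemma IsReversibleChain.expect_mul_mulVec (hrev : IsReversibleChain M π) (u v : Ω → ℝ) :
    expect π (fun x => u x * M.mulVec v x) = expect π (fun x => v x * M.mulVec u x) := by
  simp only [expect, Matrix.mulVec, dotProduct, Finset.mul_sum]
  rw [Finset.sum_comm]
  refine Finset.sum_congr rfl fun y _ => Finset.sum_congr rfl fun x _ => ?_
  linear_combination u x * v y * hrev x y

lemma l2Contraction_le_secondEigenvalue (hM : M ∈ Matrix.rowStochastic ℝ Ω)
    (hπ : IsStationaryDist M π) (hirr : M.IsIrreducible) (hrev : IsReversibleChain M π) :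
    l2Contraction M π ≤ secondEigenvalue M := by
  have hpos := stationary_pos hM hirr hπ
  obtain ⟨h, h0, h1, hl⟩ := exists_l2Norm_mulVec_eq_l2Contraction hM hπ hpos
  have hc := contractsMeanZero_l2Contraction hM hπ
  rcases (l2Contraction_nonneg M π).eq_or_lt with hl0 | hl0
  · rw [← hl0]
    exact secondEigenvalue_nonneg M
  set l := l2Contraction M π
  -- By self-adjointness ⟨h, M² h⟩ = ‖M h‖² = l², so ‖M² h - l² h‖² ≤ l⁴ - 2 l⁴ + l⁴ = 0.
  have hMM : M.mulVec (M.mulVec h) = l ^ 2 • h := by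
    have h2 := hc (M.mulVec h) ((expect_mulVec hπ h).trans h0)
    rw [hl] at h2
    have h3 : expect π (fun x => h x * M.mulVec (M.mulVec h) x) = l ^ 2 := by
      rw [hrev.expect_mul_mulVec, ← hl]
      simp only [sq]
    have h4 : (fun x => (M.mulVec (M.mulVec h) x - l ^ 2 * h x) ^ 2) = fun x =>
        (M.mulVec (M.mulVec h) x ^ 2 - 2 * l ^ 2 * (h x * M.mulVec (M.mulVec h) x))
          + (l ^ 2) ^ 2 * h x ^ 2 := by
      ext x; ring
    have h5 : (fun x => M.mulVec (M.mulVec h) x - l ^ 2 * h x) = 0 := by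
      refine eq_zero_of_expect_sq_le hpos ?_
      rw [h4, expect_add, expect_sub, expect_const_mul, expect_const_mul, h3]
      nlinarith [mul_le_mul_of_nonneg_left h1 (sq_nonneg (l ^ 2))]
    exact funext fun x => sub_eq_zero.1 (congrFun h5 x)
  -- Factor M² - l² = (M - l)(M + l): either h has eigenvalue -l, or (M + l) h has eigenvalue l.
  by_cases hk : M.mulVec h + l • h = 0
  · have hMh : M.mulVec h = (-l) • h := by
      rw [neg_smul]
      exact eq_neg_of_add_eq_zero_left hk
    have hh : h ≠ 0 := by
      rintro rfl
      simp [expect] at hl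
      exact (pow_pos hl0 2).ne hl
    have := abs_le_secondEigenvalue hh hMh (by linarith)
    rwa [abs_neg, abs_of_pos hl0] at this
  · have hMk : M.mulVec (M.mulVec h + l • h) = l • (M.mulVec h + l • h) := by
      rw [Matrix.mulVec_add, Matrix.mulVec_smul, hMM, smul_add, smul_smul, ← sq, add_comm]
    have hl1 : l ≠ 1 := by
      intro h1l
      refine hk (eq_zero_of_mulVec_eq_self hM hirr hπ.1 ?_ ?_)
      · rw [hMk, h1l, one_smul]
      · have : M.mulVec h + l • h = fun x => M.mulVec h x + l * h x := rfl
        rw [this, expect_add, expect_const_mul, expect_mulVec hπ, h0, mul_zero, add_zero]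
    have := abs_le_secondEigenvalue hk hMk hl1
    rwa [abs_of_pos hl0] at this

lemma contractsMeanZero_secondEigenvalue (hM : M ∈ Matrix.rowStochastic ℝ Ω)
    (hπ : IsStationaryDist M π) (hirr : M.IsIrreducible) (hrev : IsReversibleChain M π) :
    ContractsMeanZero M π (secondEigenvalue M) := fun h h0 =>
  (contractsMeanZero_l2Contraction hM hπ h h0).trans <| mul_le_mul_of_nonneg_right
    (pow_le_pow_left₀ (l2Contraction_nonneg M π)
      (l2Contraction_le_secondEigenvalue hM hπ hirr hrev) 2)
    (expect_nonneg hπ.1 fun _ => sq_nonneg _)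

end SecondEigenvalue

/-! ### The variance estimator and its confidence bound -/

section Estimator

variable {Ω : Type*} [Fintype Ω] {M : Matrix Ω Ω ℝ} {π : Ω → ℝ}

lemma stationaryVariance_nonneg (hπ : π ∈ stdSimplex ℝ Ω) (f : Ω → ℝ) :
    0 ≤ stationaryVariance π f :=
  expect_nonneg hπ fun _ => sq_nonneg _

lemma expect_pairDist_sq_sub (hπ : π ∈ stdSimplex ℝ Ω) (f : Ω → ℝ) :
    expect (pairDist π) (fun p => (f p.1 - f p.2) ^ 2) = 2 * stationaryVariance π f := by
  have h1 : ∀ c, expect π (fun y => (c - f y) ^ 2) =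
      c ^ 2 - 2 * expect π f * c + expect π (fun y => f y ^ 2) := fun c => by
    have : (fun y => (c - f y) ^ 2) = fun y => (c ^ 2 - 2 * c * f y) + f y ^ 2 := by
      ext y; ring
    rw [this, expect_add, expect_sub, expect_const hπ, expect_const_mul]
    ring
  have h2 : (fun x => (f x - expect π f) ^ 2) = fun x => (expect π f - f x) ^ 2 := by
    ext x; ring
  rw [expect_pairDist, stationaryVariance, h2, h1]
  simp only [h1]
  rw [expect_add, expect_sub, expect_const hπ, expect_const_mul]
  ring

variable [MeasurableSpace Ω] [MeasurableSingletonClass Ω] {S : Type*} [MeasurableSpace S]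
  {P : Measure S} [IsProbabilityMeasure P] {m : ℕ} {X₁ X₂ : Fin m → S → Ω}

lemma integrable_pair (hX₁ : IsStationaryTrace P M π X₁) (hX₂ : IsStationaryTrace P M π X₂)
    (G : (Fin m → Ω × Ω) → ℝ) : Integrable (fun s => G fun i => (X₁ i s, X₂ i s)) P := by
  have hY : Measurable fun s i => (X₁ i s, X₂ i s) :=
    measurable_pi_lambda _ fun i => (hX₁.1 i).prodMk (hX₂.1 i)
  have : IsFiniteMeasure (P.map fun s i => (X₁ i s, X₂ i s)) := Measure.isFiniteMeasure_map _ _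
  exact (Integrable.of_finite (f := G)).comp_measurable hY

lemma integral_pair (hX₁ : IsStationaryTrace P M π X₁) (hX₂ : IsStationaryTrace P M π X₂)
    (hindep : IndepFun (fun s i => X₁ i s) (fun s i => X₂ i s) P) (G : (Fin m → Ω × Ω) → ℝ) :
    ∫ s, G (fun i => (X₁ i s, X₂ i s)) ∂P =
      ∑ w, traceProb (pairMatrix M) (pairDist π) w * G w := by
  have hY : Measurable fun s i => (X₁ i s, X₂ i s) :=
    measurable_pi_lambda _ fun i => (hX₁.1 i).prodMk (hX₂.1 i)
  have : IsFiniteMeasure (P.map fun s i => (X₁ i s, X₂ i s)) := Measure.isFiniteMeasure_map _ _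
  rw [← integral_map (f := G) hY.aemeasurable (measurable_of_finite G).aestronglyMeasurable,
    integral_fintype Integrable.of_finite]
  refine Finset.sum_congr rfl fun w _ => ?_
  rw [smul_eq_mul, map_measureReal_apply hY (measurableSet_singleton w)]
  congr 1
  have hset : (fun s i => (X₁ i s, X₂ i s)) ⁻¹' {w} =
      (fun s i => X₁ i s) ⁻¹' {fun i => (w i).1} ∩ (fun s i => X₂ i s) ⁻¹' {fun i => (w i).2} := by
    ext s
    simp [funext_iff, Prod.ext_iff, forall_and]
  have h1 := hX₁.2 fun i => (w i).1
  have h2 := hX₂.2 fun i => (w i).2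
  have hs1 : {s | ∀ i, X₁ i s = (w i).1} = (fun s i => X₁ i s) ⁻¹' {fun i => (w i).1} := by
    ext s; simp [funext_iff]
  have hs2 : {s | ∀ i, X₂ i s = (w i).2} = (fun s i => X₂ i s) ⁻¹' {fun i => (w i).2} := by
    ext s; simp [funext_iff]
  rw [hs1] at h1
  rw [hs2] at h2
  rw [hset, measureReal_def, hindep.measure_inter_preimage_eq_mul _ _
    (measurableSet_singleton _) (measurableSet_singleton _), ENNReal.toReal_mul,
    ← measureReal_def, ← measureReal_def, h1, h2, ← traceProb_pair]

lemma integral_twoChainEstimator [DecidableEq Ω] (hM : M ∈ Matrix.rowStochastic ℝ Ω)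
    (hπ : IsStationaryDist M π) (hm : 1 ≤ m) (hX₁ : IsStationaryTrace P M π X₁)
    (hX₂ : IsStationaryTrace P M π X₂)
    (hindep : IndepFun (fun s i => X₁ i s) (fun s i => X₂ i s) P) (f : Ω → ℝ) :
    ∫ s, twoChainEstimator f X₁ X₂ s ∂P = stationaryVariance π f := by
  have h1 := integral_pair hX₁ hX₂ hindep
    (fun w => 1 / (2 * (m : ℝ)) * ∑ i, (f (w i).1 - f (w i).2) ^ 2)
  refine h1.trans ?_
  have hm0 : (m : ℝ) ≠ 0 := by exact_mod_cast (by omega : m ≠ 0)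
  simp only [mul_left_comm _ (1 / (2 * (m : ℝ))), ← Finset.mul_sum]
  simp only [Finset.mul_sum (s := Finset.univ (α := Fin m))]
  rw [Finset.sum_comm]
  simp only [fun i => sum_traceProb_mul_eval (pairMatrix_mem_rowStochastic hM)
    (isStationaryDist_pair hπ) (fun p => (f p.1 - f p.2) ^ 2) (m := m) i,
    expect_pairDist_sq_sub hπ.1, Finset.sum_const, Finset.card_univ, Fintype.card_fin,
    nsmul_eq_mul]
  field_simp

/-- The lower tail of a sum over two independent stationary traces. -/
lemma measureReal_sum_le [DecidableEq Ω] (hM : M ∈ Matrix.rowStochastic ℝ Ω)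
    (hπ : IsStationaryDist M π) {l : ℝ} (hl : 0 ≤ l) (hl1 : l < 1)
    (hc : ContractsMeanZero M π l) (hm : 1 ≤ m) (hX₁ : IsStationaryTrace P M π X₁)
    (hX₂ : IsStationaryTrace P M π X₂)
    (hindep : IndepFun (fun s i => X₁ i s) (fun s i => X₂ i s) P)
    {g : Ω × Ω → ℝ} (hg0 : ∀ p, 0 ≤ g p) (hg1 : ∀ p, g p ≤ 1) {t : ℝ} (ht : 0 ≤ t) (c : ℝ) :
    P.real {s | ∑ i, g (X₁ i s, X₂ i s) ≤ c} ≤ Real.exp (t * c -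
      m * (expect (pairDist π) g * (t - (1 + l) / (1 - l) * t ^ 2 / 2))) := by
  have h1 := measure_le_le_exp_mul_mgf (μ := P) (X := fun s => ∑ i, g (X₁ i s, X₂ i s)) c
    (neg_nonpos.2 ht)
    (integrable_pair hX₁ hX₂ fun w => Real.exp (-t * ∑ i, g (w i)))
  refine h1.trans ?_
  rw [mgf, integral_pair hX₁ hX₂ hindep (fun w => Real.exp (-t * ∑ i, g (w i))), neg_neg,
    sub_eq_add_neg, Real.exp_add]
  exact mul_le_mul_of_nonneg_left (sum_traceProb_mul_exp_le (pairMatrix_mem_rowStochastic hM)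
    (isStationaryDist_pair hπ) hl hl1 (hc.pair hM hπ) hg0 hg1 ht hm) (Real.exp_pos _).le

/-- Since v - w is at least both √(B w) and B + √(B w), (v - w)² ≥ B (v - w) + B w = B v. -/
lemma add_sqrt_le_of_le {B C v w : ℝ} (hB : 0 ≤ B) (hBC : B ≤ C) (hw : 0 ≤ w)
    (h : w + C + √(B * w) ≤ v) : w ≤ v - √(B * v) := by
  have h1 := Real.sqrt_nonneg (B * w)
  have h2 := Real.sq_sqrt (mul_nonneg hB hw)
  have h3 : √(B * v) ≤ v - w := by
    refine Real.sqrt_le_iff.2 ⟨by linarith, ?_⟩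
    nlinarith [mul_le_mul_of_nonneg_left (show √(B * w) ≤ v - w by linarith) h1,
      mul_le_mul_of_nonneg_left (show B + √(B * w) ≤ v - w by linarith)
        (show 0 ≤ v - w by linarith)]
  linarith

lemma measureReal_upperBound_le [DecidableEq Ω] (hM : M ∈ Matrix.rowStochastic ℝ Ω)
    (hπ : IsStationaryDist M π) {a b : ℝ} (hab : a < b) {f : Ω → ℝ}
    (hf : ∀ x, f x ∈ Set.Icc a b) {l : ℝ} (hl : 0 ≤ l) (hl1 : l < 1)
    (hc : ContractsMeanZero M π l) (hm : 1 ≤ m) (hX₁ : IsStationaryTrace P M π X₁)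
    (hX₂ : IsStationaryTrace P M π X₂)
    (hindep : IndepFun (fun s i => X₁ i s) (fun s i => X₂ i s) P)
    {δ : ℝ} (hδ : 0 < δ) (hδ1 : δ < 1) :
    P.real {s | upperBound l (b - a) δ m (twoChainEstimator f X₁ X₂ s) ≤
      stationaryVariance π f} ≤ δ := by
  have hR : 0 < b - a := sub_pos.2 hab
  set R := b - a with hRdef
  have hq : 0 < 1 - l := sub_pos.2 hl1
  have hm0 : (0 : ℝ) < m := by exact_mod_cast hm
  have hL : 0 < Real.log (1 / δ) := Real.log_pos ((one_lt_div hδ).2 hδ1)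
  have hLexp : Real.exp (-Real.log (1 / δ)) = δ := by
    rw [one_div, Real.log_inv, neg_neg, Real.exp_log hδ]
  set L := Real.log (1 / δ)
  set v := stationaryVariance π f with hv
  set B := (1 + l) * R ^ 2 * L / ((1 - l) * m) with hBdef
  set C := (11 + √21) * (1 + l / √21) * R ^ 2 * L / ((1 - l) * m) with hCdef
  have hB : 0 < B := by positivity
  have hBC : B ≤ C := by
    have h21 : 0 < √(21 : ℝ) := by positivity
    have h1 : 1 + l ≤ (11 + √21) * (1 + l / √21) := by
      have : (11 + √21) * (1 + l / √21) = 11 + √21 + 11 * (l / √21) + l := by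
        field_simp
        ring
      have : 0 ≤ l / √21 := by positivity
      linarith
    rw [hBdef, hCdef]
    gcongr
  have hest : ∀ s, 0 ≤ twoChainEstimator f X₁ X₂ s := fun s =>
    mul_nonneg (by positivity) (Finset.sum_nonneg fun _ _ => sq_nonneg _)
  have hsub : {s | upperBound l R δ m (twoChainEstimator f X₁ X₂ s) ≤ v} ⊆
      {s | twoChainEstimator f X₁ X₂ s ≤ v - √(B * v)} := fun s hs => by
    refine add_sqrt_le_of_le hB.le hBC (hest s) ?_
    have h1 : (1 + l) * R ^ 2 * twoChainEstimator f X₁ X₂ s * L / ((1 - l) * m) =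
        B * twoChainEstimator f X₁ X₂ s := by
      rw [hBdef]; ring
    have h2 : upperBound l R δ m (twoChainEstimator f X₁ X₂ s) ≤ v := hs
    rwa [upperBound, h1] at h2
  -- The optimal t below divides by v; for v = 0 the event is empty because the additive term is
  -- positive.
  rcases (stationaryVariance_nonneg hπ.1 f).eq_or_lt with hv0 | hv0
  · have hempty : {s | upperBound l R δ m (twoChainEstimator f X₁ X₂ s) ≤ v} = ∅ := by
      refine Set.eq_empty_of_forall_notMem fun s hs => ?_
      have h2 : upperBound l R δ m (twoChainEstimator f X₁ X₂ s) ≤ v := hs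
      rw [upperBound, hv, ← hv0] at h2
      have := hest s
      have := Real.sqrt_nonneg
        ((1 + l) * R ^ 2 * twoChainEstimator f X₁ X₂ s * L / ((1 - l) * m))
      linarith [hB.trans_le hBC]
    rw [hempty, measureReal_empty]
    exact hδ.le
  rw [← hv] at hv0
  set β := (1 + l) / (1 - l) with hβdef
  have hβ : 0 < β := by positivity
  have hBβ : B = β * R ^ 2 * L / m := by
    rw [hBdef, hβdef]; field_simp
  set g : Ω × Ω → ℝ := fun p => 1 / R ^ 2 * (f p.1 - f p.2) ^ 2 with hg
  have hg0 : ∀ p, 0 ≤ g p := fun p => by positivity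
  have hg1 : ∀ p, g p ≤ 1 := fun p => by
    have h1 := hf p.1
    have h2 := hf p.2
    have h3 : (f p.1 - f p.2) ^ 2 ≤ R ^ 2 :=
      sq_le_sq' (by linarith [h1.1, h2.2]) (by linarith [h1.2, h2.1])
    change 1 / R ^ 2 * (f p.1 - f p.2) ^ 2 ≤ 1
    rw [one_div_mul_eq_div]
    exact div_le_one_of_le₀ h3 (sq_nonneg _)
  have hEg : expect (pairDist π) g = 2 * v / R ^ 2 := by
    rw [hg, expect_const_mul, expect_pairDist_sq_sub hπ.1, one_div_mul_eq_div]
  have hset : {s | twoChainEstimator f X₁ X₂ s ≤ v - √(B * v)} ⊆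
      {s | ∑ i, g (X₁ i s, X₂ i s) ≤ 2 * m / R ^ 2 * (v - √(B * v))} := fun s hs => by
    have h1 : ∑ i, g (X₁ i s, X₂ i s) = 2 * m / R ^ 2 * twoChainEstimator f X₁ X₂ s := by
      simp only [hg, twoChainEstimator, ← Finset.mul_sum]
      field_simp
    change ∑ i, g (X₁ i s, X₂ i s) ≤ _
    rw [h1]
    exact mul_le_mul_of_nonneg_left hs (by positivity)
  refine (measureReal_mono (hsub.trans hset)).trans ?_
  -- This t minimises the quadratic exponent, whose minimum -m B / (R² β) equals -ln(1/δ).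
  refine (measureReal_sum_le hM hπ hl hl1 hc hm hX₁ hX₂ hindep hg0 hg1
    (t := √(B * v) / (v * β)) (by positivity) _).trans ?_
  rw [hEg, ← hβdef, ← hLexp]
  refine (congrArg Real.exp ?_).le
  have hsq : √(B * v) ^ 2 = β * R ^ 2 * L / m * v := by
    rw [Real.sq_sqrt (by positivity), hBβ]
  have h1 : √(B * v) / (v * β) * (2 * m / R ^ 2 * (v - √(B * v))) -
      m * (2 * v / R ^ 2 * (√(B * v) / (v * β) - β * (√(B * v) / (v * β)) ^ 2 / 2)) =
      -(m / (R ^ 2 * v * β) * √(B * v) ^ 2) := by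
    field_simp
    ring
  rw [h1, hsq]
  field_simp

end Estimator

end TraceVariance

theorem mainTheorem6 {Ω : Type*} [Fintype Ω] [DecidableEq Ω] [MeasurableSpace Ω]
    [MeasurableSingletonClass Ω]
    (M : Matrix Ω Ω ℝ) (hM : M ∈ Matrix.rowStochastic ℝ Ω)
    (π : Ω → ℝ) (hπ : TraceVariance.IsStationaryDist M π)
    (a b : ℝ) (hab : a < b) (f : Ω → ℝ) (hf : ∀ x, f x ∈ Set.Icc a b)
    {S : Type*} [MeasurableSpace S] (P : Measure S) [IsProbabilityMeasure P]
    (m : ℕ) (hm : 1 ≤ m) (X₁ X₂ : Fin m → S → Ω)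
    (hX₁ : TraceVariance.IsStationaryTrace P M π X₁)
    (hX₂ : TraceVariance.IsStationaryTrace P M π X₂)
    (hindep : IndepFun (fun s i => X₁ i s) (fun s i => X₂ i s) P) :
    (Integrable (TraceVariance.twoChainEstimator f X₁ X₂) P ∧
      ∫ s, TraceVariance.twoChainEstimator f X₁ X₂ s ∂P =
        TraceVariance.stationaryVariance π f) ∧
    (TraceVariance.IsErgodicChain M → TraceVariance.IsReversibleChain M π →
      TraceVariance.secondEigenvalue M < 1 ∧
      ∀ δ : ℝ, 0 < δ → δ < 1 →
        P.real {s | TraceVariance.upperBound (TraceVariance.secondEigenvalue M) (b - a) δ m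
            (TraceVariance.twoChainEstimator f X₁ X₂ s) ≤
          TraceVariance.stationaryVariance π f} ≤ δ) ∧
    (TraceVariance.IsErgodicChain M → TraceVariance.IsLazy M →
      TraceVariance.l2Contraction M π < 1) ∧
    (TraceVariance.l2Contraction M π < 1 →
      ∀ δ : ℝ, 0 < δ → δ < 1 →
        P.real {s | TraceVariance.upperBound (TraceVariance.l2Contraction M π) (b - a) δ m
            (TraceVariance.twoChainEstimator f X₁ X₂ s) ≤
          TraceVariance.stationaryVariance π f} ≤ δ) := by
  refine ⟨⟨?_, TraceVariance.integral_twoChainEstimator hM hπ hm hX₁ hX₂ hindep f⟩,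
    fun herg hrev => ?_, fun herg hlazy =>
      TraceVariance.l2Contraction_lt_one_of_isLazy hM hπ herg.1 hlazy, fun hl δ hδ hδ1 => ?_⟩
  · exact TraceVariance.integrable_pair hX₁ hX₂
      fun w => 1 / (2 * (m : ℝ)) * ∑ i, (f (w i).1 - f (w i).2) ^ 2
  · have hlt := TraceVariance.secondEigenvalue_lt_one hM hπ herg
    exact ⟨hlt, fun δ hδ hδ1 => TraceVariance.measureReal_upperBound_le hM hπ hab hf
      (TraceVariance.secondEigenvalue_nonneg M) hlt
      (TraceVariance.contractsMeanZero_secondEigenvalue hM hπ herg.1 hrev) hm hX₁ hX₂ hindep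
      hδ hδ1⟩
  · exact TraceVariance.measureReal_upperBound_le hM hπ hab hf
      (TraceVariance.l2Contraction_nonneg M π) hl
      (TraceVariance.contractsMeanZero_l2Contraction hM hπ) hm hX₁ hX₂ hindep hδ hδ1
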